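/- Let $\ell>0$ and let $\gamma:[0,\ell]\to\mathbb R$ be a smooth function such that $\gamma(0)=\gamma(\ell)=0$, $\gamma>0$ on $(0,\ell)$, $\dot\gamma(0)=1$, $\dot\gamma(\ell)=-1$, $|\dot\gamma|<1$ on $(0,\ell)$, all derivatives of $\gamma$ of even order vanish at $0$ and at $\ell$, and $\int_0^\ell\gamma(t)\,dt=2$ (a normalised profile function). Let $S^2_\gamma$ be the two-sphere obtained from $[0,\ell]\times\mathbb R/2\pi\mathbb Z$ (coordinates $(t,\theta)$) by collapsing each of the two boundary circles to a point, oriented by $dt\wedge d\theta$ and endowed with the smooth Riemannian metric $g_\gamma=dt^2+\gamma(t)^2d\theta^2$. Let $\mu_\gamma=\gamma\,dt\wedge d\theta$ be its area form and $K=-\ddot\gamma/\gamma$ its Gaussian curvature (extended continuously to the poles). Put $$m_\gamma:=\inf\Big\{\|\beta\|\ :\ \beta\in\Omega^1(S^2_\gamma),\ d\beta=(1-K)\mu_\gamma\Big\},\qquad \|\beta\|:=\sup_{x}\ \sup_{g_\gamma(v,v)=1}|\beta_x(v)|.$$ On $TS^2_\gamma$ with projection $\pi$ let $E(x,v)=\tfrac12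 g_\gamma(v,v)$, let $\lambda_{(x,v)}(\xi)=g_\gamma(v,d\pi\,\xi)$, and for $m>0$ let $\Sigma_m=\{E=\tfrac12m^2\}$, oriented by the volume form $\lambda\wedge d\lambda|_{\Sigma_m}$. For $s\ge 0$, the form $(d\lambda-s\,\pi^*\mu_\gamma)|_{\Sigma_m}$ is said to be of positive contact type if it has a primitive $\alpha\in\Omega^1(\Sigma_m)$ such that $\alpha\wedge d\alpha$ is a positive volume form on $\Sigma_m$ (that is, $\alpha$ is a contact form whose Reeb vector field is a positive section of the characteristic distribution). Let $$\mathrm{Con}_\gamma:=\{0\}\cup\Big\{m>0\ :\ \big(d\lambda-\tfrac1m\,\pi^*\mu_\gamma\big)\big|_{\Sigma_1}\text{ is of positive contact type}\Big\}.$$ Suppose that $\gamma(t)=\gamma(\ell-t)$ for all $t\in[0,\ell]$ and that $K$ is (weakly) increasing in $t$ on $[0,\ell/2]$. Then $m_\gamma\le 1$. Moreover $\mathrm{Con}_\gamma=[0,+\infty)$, that is, every energy level of the magnetic system $(S^2_\gamma,g_\gamma,\mu_\gamma)$ is of contact type: for every $m>0$, $(d\lambda-\pi^*\mu_\gamma)|_{\Sigma_m}$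 is of positive contact type. -/

import Mathlib

open Set Complex
open scoped ContDiff

noncomputable section

namespace RevSphere

/-! ## Profile functions -/

/-- `γ : [0, ℓ] → ℝ` is a profile function.  Only the values of `γ` on `[0, ℓ]` matter, so all
derivatives are taken within `[0, ℓ]`. -/
structure IsProfile (ℓ : ℝ) (γ : ℝ → ℝ) : Prop where
  length_pos : 0 < ℓ
  smooth : ContDiffOn ℝ ∞ γ (Icc 0 ℓ)
  zero_left : γ 0 = 0
  zero_right : γ ℓ = 0
  pos : ∀ t ∈ Ioo 0 ℓ, 0 < γ t
  deriv_left : derivWithin γ (Icc 0 ℓ) 0 = 1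
  deriv_right : derivWithin γ (Icc 0 ℓ) ℓ = -1
  abs_deriv_lt : ∀ t ∈ Ioo 0 ℓ, |derivWithin γ (Icc 0 ℓ) t| < 1
  even_left : ∀ k : ℕ, iteratedDerivWithin (2 * k) γ (Icc 0 ℓ) 0 = 0
  even_right : ∀ k : ℕ, iteratedDerivWithin (2 * k) γ (Icc 0 ℓ) ℓ = 0

/-- A profile function is normalised if the integral of `γ` is `2`, that is, if the surface of
revolution has area `4π`. -/
structure IsNormalisedProfile (ℓ : ℝ) (γ : ℝ → ℝ) : Prop extends IsProfile ℓ γ where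
  integral_eq : ∫ t in (0 : ℝ)..ℓ, γ t = 2

/-- The Gaussian curvature of the surface of revolution with metric `dt² + γ(t)² dθ²`, as a
function of `t ∈ [0, ℓ]`: it is `-γ'' / γ` away from the poles and, at the poles, the limit
`-γ''' / γ'` of this expression. -/
def curvature (ℓ : ℝ) (γ : ℝ → ℝ) (t : ℝ) : ℝ :=
  if t ∈ Ioo 0 ℓ then
    -(iteratedDerivWithin 2 γ (Icc 0 ℓ) t) / γ t
  else
    -(iteratedDerivWithin 3 γ (Icc 0 ℓ) t) / derivWithin γ (Icc 0 ℓ) t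

/-! ## The sphere `S²_γ` and its tangent bundle in charts

`S²_γ` is `[0, ℓ] × ℝ/2πℤ` with `{0} × ℝ/2πℤ` and `{ℓ} × ℝ/2πℤ` collapsed to the south and the
north pole.  Its smooth structure and orientation are given by two charts with values in the disc
of radius `ℓ` in `ℂ = ℝ²`, one around each pole:
* the complement of the north pole, with coordinate `z = t * exp (i θ)`;
* the complement of the south pole, with coordinate `z = (ℓ - t) * exp (-i θ)`.
Both are compatible with the orientation `dt ∧ dθ`, and `‖z‖` is the distance to the pole. -/

/-- The two poles, which index the two charts. -/
inductive Pole
  | south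
  | north

/-- The opposite pole. -/
def Pole.opp : Pole → Pole
  | south => north
  | north => south

/-- The image of both charts. -/
def disc (ℓ : ℝ) : Set ℂ := Metric.ball 0 ℓ

/-- The image under either chart of the common domain of the charts (the complement of both
poles). -/
def annulus (ℓ : ℝ) : Set ℂ := disc ℓ \ {0}

/-- The transition map between the two charts, in either direction. -/
def glue (ℓ : ℝ) (z : ℂ) : ℂ := ((ℓ - ‖z‖) / ‖z‖ : ℝ) • (starRingEnd ℂ) z

/-- The coordinate `t` of the point with coordinate `z` in a chart. -/
def lat (ℓ : ℝ) : Pole → ℂ → ℝ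
  | .south, z => ‖z‖
  | .north, z => ℓ - ‖z‖

/-- The induced transition map between the charts `disc ℓ × ℂ` of the tangent bundle. -/
def tglue (ℓ : ℝ) (p : ℂ × ℂ) : ℂ × ℂ := (glue ℓ p.1, fderiv ℝ (glue ℓ) p.1 p.2)

/-- The images of the charts of the complement of the zero section of the tangent bundle. -/
def tdisc (ℓ : ℝ) : Set (ℂ × ℂ) := disc ℓ ×ˢ {0}ᶜ

/-- The image of the common domain of the charts of the complement of the zero section. -/
def tannulus (ℓ : ℝ) : Set (ℂ × ℂ) := annulus ℓ ×ˢ {0}ᶜ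

/-- A smooth differential `1`-form on a manifold with an atlas of two charts that have the same
image `U` and the same overlap `W ⊆ U`, with transition map `T` in both directions: a smooth form
on `U` for each chart, such that these forms correspond to each other under `T`. -/
structure IsOneForm {E : Type*} [NormedAddCommGroup E] [NormedSpace ℝ E] (U W : Set E) (T : E → E)
    (β : Pole → E → E [⋀^Fin 1]→L[ℝ] ℝ) : Prop where
  smooth : ∀ i, ContDiffOn ℝ ∞ (β i) U
  compatible : ∀ i, ∀ x ∈ W,
    β i x = (β i.opp (T x)).compContinuousLinearMap (fderiv ℝ T x)

/-- The form `dr` of polar coordinates `z = r * exp (i φ)`, at a point `z ≠ 0`. -/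
def dr (z : ℂ) : ℂ →L[ℝ] ℝ := ‖z‖⁻¹ • (z.re • reCLM + z.im • imCLM)

/-- The form `dφ` of polar coordinates `z = r * exp (i φ)`, at a point `z ≠ 0`. -/
def dphi (z : ℂ) : ℂ →L[ℝ] ℝ := (‖z‖ ^ 2)⁻¹ • (z.re • imCLM - z.im • reCLM)

/-- The Riemannian metric `g_γ = dt² + γ(t)² dθ²` in the chart around a pole.  Its value at the pole
is the Euclidean one, which is the continuous extension. -/
def metric (ℓ : ℝ) (γ : ℝ → ℝ) (i : Pole) (z : ℂ) : ℂ →L[ℝ] ℂ →L[ℝ] ℝ :=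
  open scoped Classical in
  if z = 0 then reCLM.smulRight reCLM + imCLM.smulRight imCLM
  else (dr z).smulRight (dr z) + (γ (lat ℓ i z) ^ 2) • (dphi z).smulRight (dphi z)

/-- In polar coordinates the metric is `dr² + γ² dφ²`. -/
theorem metric_polar (ℓ : ℝ) (γ : ℝ → ℝ) (i : Pole) {r : ℝ} (hr : 0 < r) (φ a b a' b' : ℝ) :
    metric ℓ γ i (r * exp (φ * I)) ((a + r * b * I) * exp (φ * I)) ((a' + r * b' * I) * exp (φ * I))
      = a * a' + γ (lat ℓ i (r * exp (φ * I))) ^ 2 * (b * b') := by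
  have hz : (r * exp (φ * I) : ℂ) ≠ 0 := by
    simp [hr.ne']
  have hn : ‖(r * exp (φ * I) : ℂ)‖ = r := by
    simp [Complex.norm_exp_ofReal_mul_I, abs_of_pos hr]
  have h1 := Real.sin_sq_add_cos_sq φ
  have hdr : ∀ a b : ℝ, dr (r * exp (φ * I)) ((a + r * b * I) * exp (φ * I)) = a := by
    intro a b
    simp only [dr, hn]
    simp [exp_ofReal_mul_I_re, exp_ofReal_mul_I_im]
    field_simp
    linear_combination a * h1
  have hdp : ∀ a b : ℝ, dphi (r * exp (φ * I)) ((a + r * b * I) * exp (φ * I)) = b := by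
    intro a b
    simp only [dphi, hn]
    simp [exp_ofReal_mul_I_re, exp_ofReal_mul_I_im]
    field_simp
    linear_combination r * b * h1
  simp [metric, hz, hdr, hdp]

/-- The transition map sends `t * exp (i θ)` to `(ℓ - t) * exp (-i θ)`. -/
theorem glue_polar (ℓ : ℝ) {t : ℝ} (ht : 0 < t) (θ : ℝ) :
    glue ℓ (t * exp (θ * I)) = (ℓ - t) * exp (-(θ * I)) := by
  have hn : ‖(t * exp (θ * I) : ℂ)‖ = t := by
    simp [Complex.norm_exp_ofReal_mul_I, abs_of_pos ht]
  have ht' : (t : ℂ) ≠ 0 := by exact_mod_cast ht.ne'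
  simp only [glue, hn, real_smul, map_mul, conj_ofReal, ← exp_conj, conj_I]
  push_cast
  rw [mul_neg]
  field_simp

/-- The Riemannian area form `μ_γ`: the square root of the determinant of the metric times
`dx ∧ dy`. -/
def area (ℓ : ℝ) (γ : ℝ → ℝ) (i : Pole) (z u v : ℂ) : ℝ :=
  Real.sqrt (metric ℓ γ i z 1 1 * metric ℓ γ i z I I - metric ℓ γ i z 1 I ^ 2) *
    (u.re * v.im - u.im * v.re)

/-! ## The number `m_γ` -/

/-- The supremum norm of a `1`-form on `S²_γ` with respect to the metric. -/
def supNorm (ℓ : ℝ) (γ : ℝ → ℝ) (β : Pole → ℂ → ℂ [⋀^Fin 1]→L[ℝ] ℝ) : ENNReal :=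
  ⨆ (i : Pole) (z ∈ disc ℓ) (v : ℂ) (_ : metric ℓ γ i z v v = 1), ENNReal.ofReal |β i z ![v]|

/-- The smooth `1`-forms on `S²_γ` whose exterior derivative is `(1 - K) μ_γ`. -/
def primitives (ℓ : ℝ) (γ : ℝ → ℝ) : Set (Pole → ℂ → ℂ [⋀^Fin 1]→L[ℝ] ℝ) :=
  {β | IsOneForm (disc ℓ) (annulus ℓ) (glue ℓ) β ∧
    ∀ i, ∀ z ∈ disc ℓ, ∀ u v : ℂ,
      extDeriv (β i) z ![u, v] = (1 - curvature ℓ γ (lat ℓ i z)) * area ℓ γ i z u v}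

/-- The infimum of the norms of the primitives of `(1 - K) μ_γ` (with value `∞` if there were
none). -/
def mGamma (ℓ : ℝ) (γ : ℝ → ℝ) : ENNReal :=
  ⨅ β ∈ primitives ℓ γ, supNorm ℓ γ β

/-! ## Energy levels and the contact property -/

/-- The kinetic energy `E(x, v) = g_x(v, v) / 2` in a chart of the tangent bundle. -/
def energy (ℓ : ℝ) (γ : ℝ → ℝ) (i : Pole) (p : ℂ × ℂ) : ℝ :=
  metric ℓ γ i p.1 p.2 p.2 / 2

/-- The energy level `Σ_m = {E = m² / 2}` in a chart.  The unit tangent bundle is `Σ_1`. -/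
def level (ℓ : ℝ) (γ : ℝ → ℝ) (m : ℝ) (i : Pole) : Set (ℂ × ℂ) :=
  {p | p.1 ∈ disc ℓ ∧ energy ℓ γ i p = m ^ 2 / 2}

/-- The tangent space at `p` of the energy level through `p`, for `p` off the zero section. -/
def levelTangent (ℓ : ℝ) (γ : ℝ → ℝ) (i : Pole) (p : ℂ × ℂ) : Set (ℂ × ℂ) :=
  {ξ | fderiv ℝ (energy ℓ γ i) p ξ = 0}

/-- The Liouville form `λ_{(x, v)}(ξ) = g_x(v, dπ ξ)` in a chart of the tangent bundle. -/
def liouville (ℓ : ℝ) (γ : ℝ → ℝ) (i : Pole) (p : ℂ × ℂ) : (ℂ × ℂ) [⋀^Fin 1]→L[ℝ] ℝ :=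
  ContinuousAlternatingMap.ofSubsingleton ℝ (ℂ × ℂ) ℝ (0 : Fin 1)
    ((metric ℓ γ i p.1 p.2).comp (ContinuousLinearMap.fst ℝ ℂ ℂ))

/-- The magnetic form `dλ - s π^*μ_γ` in a chart of the tangent bundle. -/
def magneticForm (ℓ : ℝ) (γ : ℝ → ℝ) (s : ℝ) (i : Pole) (p ξ η : ℂ × ℂ) : ℝ :=
  extDeriv (liouville ℓ γ i) p ![ξ, η] - s * area ℓ γ i p.1 ξ.1 η.1

/-- The value on `(u, v, w)` of the wedge product of a `1`-covector and a `2`-covector. -/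
def wedge {E : Type*} [NormedAddCommGroup E] [NormedSpace ℝ E]
    (a : E [⋀^Fin 1]→L[ℝ] ℝ) (b : E [⋀^Fin 2]→L[ℝ] ℝ) (u v w : E) : ℝ :=
  a ![u] * b ![v, w] - a ![v] * b ![u, w] + a ![w] * b ![u, v]

/-- For `m > 0`: the restriction to the energy level `Σ_m` of `dλ - s π^*μ_γ` is of positive
contact type, that is, it has on `Σ_m` a primitive `α` which is a contact form and whose Reeb
vector field is a positive section of the characteristic distribution; the last two conditions
mean that `α ∧ dα` is a positive volume form on `Σ_m`.  Here `Σ_m` is oriented by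
the volume form `λ ∧ dλ`, that is, by `dλ ∧ dλ` with the outward normal first.  The smooth forms
on `Σ_m` are the restrictions of the smooth forms on the complement of the zero section (which
retracts smoothly onto `Σ_m` by rescaling tangent vectors). -/
def IsPositiveContact (ℓ : ℝ) (γ : ℝ → ℝ) (m s : ℝ) : Prop :=
  ∃ α : Pole → ℂ × ℂ → (ℂ × ℂ) [⋀^Fin 1]→L[ℝ] ℝ,
    IsOneForm (tdisc ℓ) (tannulus ℓ) (tglue ℓ) α ∧
    (∀ i, ∀ p ∈ level ℓ γ m i, ∀ ξ ∈ levelTangent ℓ γ i p, ∀ η ∈ levelTangent ℓ γ i p,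
      extDeriv (α i) p ![ξ, η] = magneticForm ℓ γ s i p ξ η) ∧
    (∀ i, ∀ p ∈ level ℓ γ m i, ∀ u ∈ levelTangent ℓ γ i p, ∀ v ∈ levelTangent ℓ γ i p,
      ∀ w ∈ levelTangent ℓ γ i p,
      0 < wedge (liouville ℓ γ i p) (extDeriv (liouville ℓ γ i) p) u v w →
      0 < wedge (α i p) (extDeriv (α i) p) u v w)

/-- The set `Con⁺(g_γ, μ_γ)` of all `s ≥ 0` such that `dλ - s π^*μ_γ` is of positive contact type
on the unit tangent bundle. -/
def conPlus (ℓ : ℝ) (γ : ℝ → ℝ) : Set ℝ := {s | 0 ≤ s ∧ IsPositiveContact ℓ γ 1 s}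

/-- The set `Con_γ`, in terms of the parameter `m = 1 / s`; by convention it contains `0`. -/
def con (ℓ : ℝ) (γ : ℝ → ℝ) : Set ℝ := {m | 0 < m ∧ 1 / m ∈ conPlus ℓ γ} ∪ {0}

end RevSphere

end

noncomputable section

namespace RevSphere

open MeasureTheory Filter Topology

/-! ## Smooth functions on symmetric intervals -/

section Division

variable {a : ℝ} {h : ℝ → ℝ}

/-! Let Γ(t) be the integral of γ over [0, t], and put β = (γ' + Γ - 1) dθ. Then dβ = (γ'' + γ) dt ∧
dθ = (1 - K) μ. The coefficient vanishes at both poles, because γ' runs from 1 to -1 while Γ runs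
from 0 to 2, and β is in fact smooth there. Its norm is the supremum of |γ' + Γ - 1| / γ. That this
is at most 1 is the only analytic estimate and the only use of the monotonicity of K
(`abs_primitive_le`); it gives the bound on `mGamma`.

For the contact property, let ψ be the Levi-Civita connection form, so that dψ = -K π^*μ. Then α = λ
+ s (ψ - π^*β) satisfies dα = dλ - s π^*μ, and on the level of speed m α ∧ dα = (1 + s² / m² - s
β(v) / m²) λ ∧ dλ. Since |β(v)| ≤ m, the factor is at least (m² - s m + s²) / m², which is positive
for all m > 0 and s ≥ 0 (`wedge_identity`, `RadialData.wedge_contactForm_pos`).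

In a chart, ψ - π^*β is the differential of the angle of v in an orthonormal frame minus a
rotationally invariant potential of μ. The first is closed, which gives dα at once without computing
dψ. Neither is globally defined: on the overlap each changes by -2 dφ, the second because the total
area is 4π, and the changes cancel.

Smoothness at the poles comes from parity. The odd extension of γ is r (1 + r² k) and Γ = r² q with
k, q smooth and even, and smooth even functions of the distance are smooth on the disc. All tensors
are written through k and q (`RadialData`); by the symmetry of γ the same pair serves both charts.
-/

theorem abs_mul_le_of_mem_Icc {s b : ℝ} (hs : s ∈ Icc (0 : ℝ) 1) {r : ℝ} (hr : |r| ≤ b) :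
    |s * r| ≤ b := by
  rw [abs_mul, abs_of_nonneg hs.1]
  nlinarith [abs_nonneg r, hs.2]

theorem deriv_contDiffOn (hh : ContDiffOn ℝ ∞ h (Ioo (-a) a)) :
    ContDiffOn ℝ ∞ (deriv h) (Ioo (-a) a) :=
  ((contDiffOn_infty_iff_deriv_of_isOpen isOpen_Ioo).1 hh).2

theorem hasDerivAt_of_contDiffOn (hh : ContDiffOn ℝ ∞ h (Ioo (-a) a)) {r : ℝ}
    (hr : r ∈ Ioo (-a) a) : HasDerivAt h (deriv h r) r :=
  ((hh.contDiffAt (isOpen_Ioo.mem_nhds hr)).differentiableAt (by simp)).hasDerivAt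

/-- Differentiation under the integral sign. The weight s ^ k makes the family of such integrals
stable under differentiation, which is what the induction on the order of smoothness needs. -/
theorem hasDerivAt_integral_pow_mul (hh : ContDiffOn ℝ ∞ h (Ioo (-a) a)) (k : ℕ) {r : ℝ}
    (hr : r ∈ Ioo (-a) a) :
    HasDerivAt (fun r => ∫ s in (0 : ℝ)..1, s ^ k * h (s * r))
      (∫ s in (0 : ℝ)..1, s ^ (k + 1) * deriv h (s * r)) r := by
  obtain ⟨b, hrb, hba⟩ := exists_between (abs_lt.2 hr)
  have hsub : Icc (-b) b ⊆ Ioo (-a) a := fun x hx => ⟨by linarith [hx.1], by linarith [hx.2]⟩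
  have hmaps : ∀ x ∈ Ioo (-b) b, ∀ s ∈ Icc (0 : ℝ) 1, s * x ∈ Icc (-b) b := fun x hx s hs =>
    abs_le.1 (abs_mul_le_of_mem_Icc hs (abs_le.2 ⟨hx.1.le, hx.2.le⟩))
  obtain ⟨C, hC⟩ := isCompact_Icc.exists_bound_of_continuousOn
    ((deriv_contDiffOn hh).continuousOn.mono hsub)
  have hrb' : r ∈ Ioo (-b) b := abs_lt.1 hrb
  have hcont : ∀ {f : ℝ → ℝ} (_ : ContinuousOn f (Ioo (-a) a)) (j : ℕ), ∀ x ∈ Ioo (-b) b,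
      ContinuousOn (fun s => s ^ j * f (s * x)) (Icc (0 : ℝ) 1) := by
    intro f hf j x hx
    exact (continuousOn_id.pow j).mul (hf.comp (by fun_prop) fun s hs => hsub (hmaps x hx s hs))
  have hint : ∀ {f : ℝ → ℝ} (_ : ContinuousOn f (Ioo (-a) a)) (j : ℕ), ∀ x ∈ Ioo (-b) b,
      IntervalIntegrable (fun s => s ^ j * f (s * x)) volume 0 1 := by
    intro f hf j x hx
    refine ContinuousOn.intervalIntegrable ?_
    rw [uIcc_of_le zero_le_one]
    exact hcont hf j x hx
  refine (intervalIntegral.hasDerivAt_integral_of_dominated_loc_of_deriv_le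
    (F' := fun r s => s ^ (k + 1) * deriv h (s * r)) (s := Ioo (-b) b) (bound := fun _ => C)
    (isOpen_Ioo.mem_nhds hrb') ?_ (hint hh.continuousOn k r hrb') ?_ ?_ ?_ ?_).2
  · filter_upwards [isOpen_Ioo.mem_nhds hrb'] with x hx
    exact (hint hh.continuousOn k x hx).def'.aestronglyMeasurable
  · exact (hint (deriv_contDiffOn hh).continuousOn (k + 1) r hrb').def'.aestronglyMeasurable
  · refine Eventually.of_forall fun s hs x hx => ?_
    rw [uIoc_of_le zero_le_one] at hs
    have hs' : s ∈ Icc (0 : ℝ) 1 := ⟨hs.1.le, hs.2⟩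
    rw [norm_mul, norm_pow, Real.norm_of_nonneg hs'.1]
    calc s ^ (k + 1) * ‖deriv h (s * x)‖ ≤ 1 * ‖deriv h (s * x)‖ := by
          gcongr
          exact pow_le_one₀ hs'.1 hs'.2
      _ ≤ C := by rw [one_mul]; exact hC _ (hmaps x hx s hs')
  · exact intervalIntegrable_const
  · refine Eventually.of_forall fun s hs x hx => ?_
    rw [uIoc_of_le zero_le_one] at hs
    have hs' : s ∈ Icc (0 : ℝ) 1 := ⟨hs.1.le, hs.2⟩
    have h1 := (hasDerivAt_of_contDiffOn hh (hsub (hmaps x hx s hs'))).comp x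
      ((hasDerivAt_id x).const_mul s)
    refine HasDerivAt.congr_deriv (h1.const_mul (s ^ k)) ?_
    rw [pow_succ]
    ring

theorem contDiffOn_integral_pow_mul (n : ℕ) : ∀ {h : ℝ → ℝ} (k : ℕ),
    ContDiffOn ℝ ∞ h (Ioo (-a) a) →
    ContDiffOn ℝ n (fun r => ∫ s in (0 : ℝ)..1, s ^ k * h (s * r)) (Ioo (-a) a) := by
  induction n with
  | zero =>
    intro h k hh
    rw [Nat.cast_zero, contDiffOn_zero]
    exact fun r hr => (hasDerivAt_integral_pow_mul hh k hr).continuousAt.continuousWithinAt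
  | succ n ih =>
    intro h k hh
    push_cast
    rw [contDiffOn_succ_iff_deriv_of_isOpen isOpen_Ioo]
    refine ⟨fun r hr => (hasDerivAt_integral_pow_mul hh k hr).differentiableAt.differentiableWithinAt,
      by simp, (ih (k + 1) (deriv_contDiffOn hh)).congr fun r hr =>
        (hasDerivAt_integral_pow_mul hh k hr).deriv⟩

/-- Hadamard's formula: the fundamental theorem of calculus after rescaling [0, r] to [0, 1]. -/
theorem dslope_eq_integral (hh : ContDiffOn ℝ ∞ h (Ioo (-a) a)) {r : ℝ} (hr : r ∈ Ioo (-a) a) :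
    dslope h 0 r = ∫ s in (0 : ℝ)..1, s ^ 0 * deriv h (s * r) := by
  rcases eq_or_ne r 0 with rfl | hr0
  · simp
  · have hsub : uIcc 0 r ⊆ Ioo (-a) a := by
      refine ordConnected_Ioo.uIcc_subset ?_ hr
      constructor <;> linarith [hr.1, hr.2]
    rw [dslope_of_ne _ hr0, slope_def_field, sub_zero]
    have h1 : ∫ x in (0 : ℝ)..r, deriv h x = h r - h 0 :=
      intervalIntegral.integral_eq_sub_of_hasDerivAt
        (fun x hx => hasDerivAt_of_contDiffOn hh (hsub hx))
        (((deriv_contDiffOn hh).continuousOn.mono hsub).intervalIntegrable)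
    simp only [pow_zero, one_mul]
    rw [intervalIntegral.integral_comp_mul_right _ hr0, zero_mul, one_mul, h1, smul_eq_mul]
    field_simp

/-- The difference quotient of a smooth function is smooth. -/
theorem contDiffOn_dslope (hh : ContDiffOn ℝ ∞ h (Ioo (-a) a)) :
    ContDiffOn ℝ ∞ (dslope h 0) (Ioo (-a) a) :=
  contDiffOn_infty.2 fun n => (contDiffOn_integral_pow_mul n 0 (deriv_contDiffOn hh)).congr
    fun _ hr => dslope_eq_integral hh hr

theorem eq_add_mul_dslope (h : ℝ → ℝ) (r : ℝ) : h r = h 0 + r * dslope h 0 r := by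
  have := sub_smul_dslope h 0 r
  simp only [sub_zero, smul_eq_mul] at this
  linarith

theorem deriv_even (he : ∀ r, h (-r) = h r) (r : ℝ) : deriv h (-r) = -deriv h r := by
  have h1 := deriv_comp_neg h r
  simp only [he] at h1
  linarith

theorem deriv_even_zero (he : ∀ r, h (-r) = h r) : deriv h 0 = 0 := by
  have := deriv_even he 0
  rw [neg_zero] at this
  linarith

theorem odd_zero (ho : ∀ r, h (-r) = -h r) : h 0 = 0 := by
  have := ho 0
  rw [neg_zero] at this
  linarith

theorem dslope_odd (ho : ∀ r, h (-r) = -h r) (r : ℝ) : dslope h 0 (-r) = dslope h 0 r := by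
  rcases eq_or_ne r 0 with rfl | hr
  · simp
  · rw [dslope_of_ne _ hr, dslope_of_ne _ (neg_ne_zero.2 hr), slope_def_field, slope_def_field,
      ho, odd_zero ho, sub_zero, sub_zero, sub_zero, sub_zero, neg_div_neg_eq]

theorem dslope_even (he : ∀ r, h (-r) = h r) (r : ℝ) : dslope h 0 (-r) = -dslope h 0 r := by
  rcases eq_or_ne r 0 with rfl | hr
  · simp [deriv_even_zero he]
  · rw [dslope_of_ne _ hr, dslope_of_ne _ (neg_ne_zero.2 hr), slope_def_field, slope_def_field, he,
      sub_zero, sub_zero, div_neg]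

/-- For an even function `h` this is `(h r - h 0) / r ^ 2`. -/
def divSq (h : ℝ → ℝ) : ℝ → ℝ := dslope (dslope h 0) 0

theorem contDiffOn_divSq (hh : ContDiffOn ℝ ∞ h (Ioo (-a) a)) :
    ContDiffOn ℝ ∞ (divSq h) (Ioo (-a) a) :=
  contDiffOn_dslope (contDiffOn_dslope hh)

theorem divSq_even (he : ∀ r, h (-r) = h r) (r : ℝ) : divSq h (-r) = divSq h r :=
  dslope_odd (dslope_even he) r

theorem eq_add_sq_mul_divSq (he : ∀ r, h (-r) = h r) (r : ℝ) : h r = h 0 + r ^ 2 * divSq h r := by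
  rw [eq_add_mul_dslope h r, eq_add_mul_dslope (dslope h 0) r, dslope_same, deriv_even_zero he,
    divSq]
  ring

/-- A smooth function is determined by its product with the identity. -/
theorem eqOn_of_mul_eq {c d : ℝ → ℝ} (hc : ContinuousOn c (Ioo (-a) a))
    (hd : ContinuousOn d (Ioo (-a) a)) (hcd : ∀ r ∈ Ioo (-a) a, r * c r = r * d r) :
    EqOn c d (Ioo (-a) a) := by
  intro r hr
  rcases eq_or_ne r 0 with rfl | hr0
  · have hmem := isOpen_Ioo.mem_nhds hr
    have h1 := (hc.continuousAt hmem).tendsto.mono_left (nhdsWithin_le_nhds (s := {0}ᶜ))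
    have h2 := (hd.continuousAt hmem).tendsto.mono_left (nhdsWithin_le_nhds (s := {0}ᶜ))
    refine tendsto_nhds_unique_of_eventuallyEq h1 h2 ?_
    filter_upwards [self_mem_nhdsWithin, nhdsWithin_le_nhds hmem] with x hx hx'
    exact mul_left_cancel₀ hx (hcd x hx')
  · exact mul_left_cancel₀ hr0 (hcd r hr)

end Division

/-! ## Extension of functions across an endpoint -/

/-- The extension of `f : [0, ℓ] → ℝ` by `f (-r) = ε * f r`. -/
def extend (ε : ℝ) (f : ℝ → ℝ) (r : ℝ) : ℝ := if 0 ≤ r then f r else ε * f (-r)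

theorem extend_of_nonneg (ε : ℝ) (f : ℝ → ℝ) {r : ℝ} (hr : 0 ≤ r) : extend ε f r = f r :=
  if_pos hr

theorem extend_of_neg (ε : ℝ) (f : ℝ → ℝ) {r : ℝ} (hr : r < 0) : extend ε f r = ε * f (-r) :=
  if_neg hr.not_ge

section Extend

variable {ℓ ε : ℝ} {f : ℝ → ℝ}

theorem hasDerivWithinAt_Icc (hf : ContDiffOn ℝ ∞ f (Icc 0 ℓ)) {r : ℝ} (hr : r ∈ Icc 0 ℓ) :
    HasDerivWithinAt f (derivWithin f (Icc 0 ℓ) r) (Icc 0 ℓ) r :=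
  ((hf.differentiableOn (by simp)) r hr).hasDerivWithinAt

/-- The one-sided derivatives at 0 have to match. For ε = -1 the hypotheses say that f vanishes at
0, for ε = 1 that its derivative does; the derivative is then the extension of opposite parity. -/
theorem hasDerivAt_extend (hf : ContDiffOn ℝ ∞ f (Icc 0 ℓ)) (h0 : f 0 = ε * f 0)
    (h1 : derivWithin f (Icc 0 ℓ) 0 = -ε * derivWithin f (Icc 0 ℓ) 0) {r : ℝ}
    (hr : r ∈ Ioo (-ℓ) ℓ) :
    HasDerivAt (extend ε f) (extend (-ε) (derivWithin f (Icc 0 ℓ)) r) r := by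
  rcases lt_trichotomy r 0 with hr0 | rfl | hr0
  · rw [extend_of_neg _ _ hr0]
    have h2 := (hasDerivWithinAt_Icc hf (r := -r) ⟨by linarith, by linarith [hr.1]⟩).hasDerivAt
      (Icc_mem_nhds (by linarith) (by linarith [hr.1]))
    have h3 := (h2.comp r (hasDerivAt_neg r)).const_mul ε
    have h4 : extend ε f =ᶠ[𝓝 r] fun x => ε * f (-x) := by
      filter_upwards [gt_mem_nhds hr0] with x hx using extend_of_neg _ _ hx
    refine (h3.congr_deriv ?_).congr_of_eventuallyEq h4
    ring
  · have hℓ : 0 < ℓ := hr.2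
    rw [extend_of_nonneg _ _ le_rfl]
    have h2 := hasDerivWithinAt_Icc hf (r := 0) ⟨le_rfl, hℓ.le⟩
    have h3 : HasDerivWithinAt (extend ε f) (derivWithin f (Icc 0 ℓ) 0) (Ici 0) 0 := by
      refine (h2.mono_of_mem_nhdsWithin (Icc_mem_nhdsGE hℓ)).congr
        (fun x hx => extend_of_nonneg _ _ hx) (extend_of_nonneg _ _ le_rfl)
    have h4 : HasDerivWithinAt (extend ε f) (derivWithin f (Icc 0 ℓ) 0) (Iic 0) 0 := by
      have h5 : HasDerivWithinAt f (derivWithin f (Icc 0 ℓ) 0) (Ici 0) (-0) := by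
        rw [neg_zero]; exact h2.mono_of_mem_nhdsWithin (Icc_mem_nhdsGE hℓ)
      have h6 := (h5.comp 0 (hasDerivAt_neg (0 : ℝ)).hasDerivWithinAt
        (s := Iic 0) fun x hx => by simpa using hx).const_mul ε
      refine (h6.congr_deriv ?_).congr (fun x hx => ?_) ?_
      · linarith
      · rcases eq_or_lt_of_le (mem_Iic.1 hx) with rfl | hx
        · rw [extend_of_nonneg _ _ le_rfl]; simpa using h0
        · exact extend_of_neg _ _ hx
      · rw [extend_of_nonneg _ _ le_rfl]; simpa using h0
    have h7 := h4.union h3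
    rwa [Iic_union_Ici, hasDerivWithinAt_univ] at h7
  · rw [extend_of_nonneg _ _ hr0.le]
    have h2 := (hasDerivWithinAt_Icc hf (r := r) ⟨hr0.le, hr.2.le⟩).hasDerivAt
      (Icc_mem_nhds hr0 hr.2)
    refine h2.congr_of_eventuallyEq ?_
    filter_upwards [lt_mem_nhds hr0] with x hx using extend_of_nonneg _ _ hx.le

/-- The condition says that the derivatives at 0 of the wrong parity vanish. It passes to the
derivative with -ε in place of ε, so the induction runs over both parities at once. -/
theorem contDiffOn_extend (hℓ : 0 < ℓ) (n : ℕ) : ∀ {f : ℝ → ℝ} {ε : ℝ},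
    ContDiffOn ℝ ∞ f (Icc 0 ℓ) →
    (∀ k, iteratedDerivWithin k f (Icc 0 ℓ) 0
      = ε * (-1) ^ k * iteratedDerivWithin k f (Icc 0 ℓ) 0) →
    ContDiffOn ℝ n (extend ε f) (Ioo (-ℓ) ℓ) := by
  induction n with
  | zero =>
    intro f ε hf hk
    rw [Nat.cast_zero, contDiffOn_zero]
    have h0 := hk 0
    have h1 := hk 1
    simp only [iteratedDerivWithin_zero, iteratedDerivWithin_one, pow_zero, pow_one] at h0 h1
    exact fun r hr => (hasDerivAt_extend hf (by linarith) (by linarith)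
      hr).continuousAt.continuousWithinAt
  | succ n ih =>
    intro f ε hf hk
    have h0 := hk 0
    have h1 := hk 1
    simp only [iteratedDerivWithin_zero, iteratedDerivWithin_one, pow_zero, pow_one] at h0 h1
    have hd : ∀ r ∈ Ioo (-ℓ) ℓ, HasDerivAt (extend ε f) _ r := fun r hr =>
      hasDerivAt_extend hf (by linarith) (by linarith) hr
    push_cast
    rw [contDiffOn_succ_iff_deriv_of_isOpen isOpen_Ioo]
    refine ⟨fun r hr => (hd r hr).differentiableAt.differentiableWithinAt, by simp, ?_⟩
    refine ContDiffOn.congr (ih (f := derivWithin f (Icc 0 ℓ)) (ε := -ε) ?_ fun k => ?_)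
      fun r hr => (hd r hr).deriv
    · exact ((contDiffOn_infty_iff_derivWithin (uniqueDiffOn_Icc hℓ)).1 hf).2
    · have := hk (k + 1)
      rw [iteratedDerivWithin_succ'] at this
      linear_combination this

end Extend

/-! ## Radial functions on the disc -/

/-- The bilinear form `x u₁ + y u₂` of the Euclidean plane. -/
def dotL (z : ℂ) : ℂ →L[ℝ] ℝ := z.re • reCLM + z.im • imCLM

/-- The form `x dy - y dx`. -/
def rot (z : ℂ) : ℂ →L[ℝ] ℝ := z.re • imCLM - z.im • reCLM

@[simp] theorem dotL_apply (z u : ℂ) : dotL z u = z.re * u.re + z.im * u.im := rfl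

@[simp] theorem rot_apply (z u : ℂ) : rot z u = z.re * u.im - z.im * u.re := rfl

theorem norm_sq_eq (z : ℂ) : ‖z‖ ^ 2 = z.re ^ 2 + z.im ^ 2 := by
  rw [Complex.sq_norm, normSq_apply]
  ring

theorem hasFDerivAt_norm {z : ℂ} (hz : z ≠ 0) :
    HasFDerivAt (fun z : ℂ => ‖z‖) (‖z‖⁻¹ • dotL z) z := by
  have h1 : DifferentiableAt ℝ (fun z : ℂ => ‖z‖) z :=
    (contDiffAt_norm ℝ hz (n := 1)).differentiableAt one_ne_zero
  have h2 := h1.hasFDerivAt.pow 2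
  have h3 := (hasStrictFDerivAt_norm_sq z).hasFDerivAt
  have h4 := h2.unique h3
  have hn : ‖z‖ ≠ 0 := norm_ne_zero_iff.2 hz
  convert h1.hasFDerivAt using 1
  ext1 u
  have h5 := DFunLike.congr_fun h4 u
  simp [Complex.inner] at h5
  simp
  field_simp
  linarith

theorem isOpen_disc (a : ℝ) : IsOpen (disc a) := Metric.isOpen_ball

section Radial

variable {a : ℝ} {e : ℝ → ℝ}

theorem norm_mem_Ioo {z : ℂ} (hz : z ∈ disc a) : ‖z‖ ∈ Ioo (-a) a := by
  have := mem_ball_zero_iff.1 hz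
  constructor <;> linarith [norm_nonneg z]

/-- For an even function `e` this is `e' r / r`. -/
def derivDiv (e : ℝ → ℝ) : ℝ → ℝ := dslope (deriv e) 0

theorem derivDiv_even (he : ∀ r, e (-r) = e r) (r : ℝ) : derivDiv e (-r) = derivDiv e r :=
  dslope_odd (deriv_even he) r

theorem contDiffOn_derivDiv (hs : ContDiffOn ℝ ∞ e (Ioo (-a) a)) :
    ContDiffOn ℝ ∞ (derivDiv e) (Ioo (-a) a) :=
  contDiffOn_dslope (deriv_contDiffOn hs)

theorem mul_derivDiv (he : ∀ r, e (-r) = e r) (r : ℝ) : r * derivDiv e r = deriv e r := by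
  rw [eq_add_mul_dslope (deriv e) r, deriv_even_zero he, zero_add, derivDiv]

theorem hasFDerivAt_radial (hs : ContDiffOn ℝ ∞ e (Ioo (-a) a)) (he : ∀ r, e (-r) = e r) {z : ℂ}
    (hz : z ∈ disc a) :
    HasFDerivAt (fun z : ℂ => e ‖z‖) (derivDiv e ‖z‖ • dotL z) z := by
  have hd := hasDerivAt_of_contDiffOn hs (norm_mem_Ioo hz)
  rcases eq_or_ne z 0 with rfl | hz0
  -- At the origin the norm is not differentiable, but evenness gives e'(0) = 0, so e(‖z‖) - e(0) is
  -- o(‖z‖).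
  · have h0 : (derivDiv e ‖(0 : ℂ)‖ • dotL 0) = 0 := by ext; simp
    rw [h0]
    rw [norm_zero, deriv_even_zero he] at hd
    have h1 := hasDerivAt_iff_isLittleO.1 hd
    rw [hasFDerivAt_iff_isLittleO]
    have h2 : Tendsto (fun z : ℂ => ‖z‖) (𝓝 0) (𝓝 0) := by
      simpa using (continuous_norm (E := ℂ)).tendsto 0
    have h3 := h1.comp_tendsto h2
    refine Asymptotics.IsLittleO.of_norm_right ?_
    simpa [Function.comp_def] using h3
  · have h1 := hd.comp_hasFDerivAt z (hasFDerivAt_norm hz0)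
    refine h1.congr_fderiv ?_
    have hn : ‖z‖ ≠ 0 := norm_ne_zero_iff.2 hz0
    rw [← mul_derivDiv he, smul_smul, mul_right_comm, mul_inv_cancel₀ hn, one_mul]

theorem contDiff_dotL : ContDiff ℝ ∞ dotL := by
  unfold dotL
  exact (reCLM.contDiff.smul contDiff_const).add (imCLM.contDiff.smul contDiff_const)

theorem contDiff_rot : ContDiff ℝ ∞ rot := by
  unfold rot
  exact (reCLM.contDiff.smul contDiff_const).sub (imCLM.contDiff.smul contDiff_const)

/-- The gradient of e(‖z‖) is (e' / r) z, and e' / r is again smooth and even, so the induction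
closes. -/
theorem contDiffOn_radial_nat (n : ℕ) : ∀ {e : ℝ → ℝ}, ContDiffOn ℝ ∞ e (Ioo (-a) a) →
    (∀ r, e (-r) = e r) → ContDiffOn ℝ n (fun z : ℂ => e ‖z‖) (disc a) := by
  induction n with
  | zero =>
    intro e hs he
    rw [Nat.cast_zero, contDiffOn_zero]
    exact fun z hz => (hasFDerivAt_radial hs he hz).continuousAt.continuousWithinAt
  | succ n ih =>
    intro e hs he
    push_cast
    rw [contDiffOn_succ_iff_fderiv_of_isOpen (isOpen_disc a)]
    refine ⟨fun z hz => (hasFDerivAt_radial hs he hz).differentiableAt.differentiableWithinAt,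
      by simp, ?_⟩
    exact ((ih (contDiffOn_derivDiv hs) (derivDiv_even he)).smul
      (contDiff_dotL.of_le (by exact_mod_cast le_top)).contDiffOn).congr fun z hz =>
        (hasFDerivAt_radial hs he hz).fderiv

/-- Smooth even functions of the distance to the origin are smooth. -/
theorem contDiffOn_radial (hs : ContDiffOn ℝ ∞ e (Ioo (-a) a)) (he : ∀ r, e (-r) = e r) :
    ContDiffOn ℝ ∞ (fun z : ℂ => e ‖z‖) (disc a) :=
  contDiffOn_infty.2 fun n => contDiffOn_radial_nat n hs he

end Radial

/-! ## The estimate for the primitive -/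

section Estimate

variable {ℓ : ℝ} {o G : ℝ → ℝ}

theorem deriv_reflect (hsymm : ∀ t ∈ Ioo 0 ℓ, o (ℓ - t) = o t) {t : ℝ} (ht : t ∈ Ioo 0 ℓ) :
    deriv o (ℓ - t) = -deriv o t := by
  have h2 : (fun y => o (ℓ - y)) =ᶠ[𝓝 t] o := by
    filter_upwards [isOpen_Ioo.mem_nhds ht] with y hy using hsymm y hy
  have h3 := h2.deriv_eq
  rw [deriv_comp_const_sub] at h3
  linarith

/-- The sum is constant by the symmetry of the integrand and equals 2 at the midpoint. -/
theorem primitive_reflect (hsymm : ∀ t ∈ Ioo 0 ℓ, o (ℓ - t) = o t)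
    (hG : ∀ t ∈ Ioo (-ℓ) ℓ, HasDerivAt G (o t) t) (hG1 : G (ℓ / 2) = 1) {t : ℝ}
    (ht : t ∈ Ioo 0 ℓ) : G t + G (ℓ - t) = 2 := by
  have hℓ : 0 < ℓ := ht.1.trans ht.2
  have hder : ∀ x ∈ Ioo 0 ℓ, HasDerivAt (fun x => G x + G (ℓ - x)) 0 x := by
    intro x hx
    have h2 := (hG (ℓ - x) ⟨by linarith [hx.2], by linarith [hx.1]⟩).comp x
      ((hasDerivAt_id x).const_sub ℓ)
    refine ((hG x ⟨by linarith [hx.1], hx.2⟩).add h2).congr_deriv ?_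
    rw [hsymm x hx]
    ring
  have h3 : G t + G (ℓ - t) = G (ℓ / 2) + G (ℓ - ℓ / 2) :=
    isOpen_Ioo.is_const_of_deriv_eq_zero (isPreconnected_Ioo)
      (fun x hx => (hder x hx).differentiableAt.differentiableWithinAt)
      (fun x hx => (hder x hx).deriv) ht ⟨by linarith, by linarith⟩
  rw [h3, sub_half, hG1]
  norm_num

/-- Here o is the odd extension of γ and f = o' + G - 1, so f' = o'' + o = (1 - K) o. As f vanishes
at 0 and at ℓ / 2, monotonicity of K forces 0 ≤ f between them; concavity of o gives f ≤ o. The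
other half follows from f(ℓ - t) = -f(t). -/
theorem abs_primitive_le (hs : ContDiffOn ℝ ∞ o (Ioo (-ℓ) ℓ)) (h0 : o 0 = 0)
    (h1 : deriv o 0 = 1) (hpos : ∀ t ∈ Ioo 0 ℓ, 0 < o t) (hd : ∀ t ∈ Ioo 0 ℓ, |deriv o t| < 1)
    (hsymm : ∀ t ∈ Ioo 0 ℓ, o (ℓ - t) = o t)
    (hK : MonotoneOn (fun t => -deriv (deriv o) t / o t) (Ioc 0 (ℓ / 2)))
    (hG : ∀ t ∈ Ioo (-ℓ) ℓ, HasDerivAt G (o t) t) (hG0 : G 0 = 0) (hG1 : G (ℓ / 2) = 1) {t : ℝ}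
    (ht : t ∈ Ico 0 ℓ) : |deriv o t + G t - 1| ≤ o t := by
  have hℓ : 0 < ℓ := ht.1.trans_lt ht.2
  have hI : ∀ {x}, x ∈ Icc 0 (ℓ / 2) → x ∈ Ioo (-ℓ) ℓ := fun {x} hx =>
    ⟨by linarith [hx.1], by linarith [hx.2]⟩
  have ho : ∀ {x}, x ∈ Ioo (-ℓ) ℓ → HasDerivAt o (deriv o x) x := fun hx =>
    hasDerivAt_of_contDiffOn hs hx
  have ho' : ∀ {x}, x ∈ Ioo (-ℓ) ℓ → HasDerivAt (deriv o) (deriv (deriv o) x) x := fun hx =>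
    hasDerivAt_of_contDiffOn (deriv_contDiffOn hs) hx
  have hdsymm : ∀ x ∈ Ioo 0 ℓ, deriv o (ℓ - x) = -deriv o x := fun x hx => deriv_reflect hsymm hx
  have hmid : deriv o (ℓ / 2) = 0 := by
    have := hdsymm (ℓ / 2) ⟨by linarith, by linarith⟩
    rw [sub_half] at this
    linarith
  -- If K were negative at x, it would be negative on all of (0, x], so o' would exceed its initial
  -- value 1 somewhere before or at x; the mean value theorem turns this into o'(x) > 1, against
  -- |o'| < 1.
  have hneg : ∀ x ∈ Ioo 0 (ℓ / 2), deriv (deriv o) x ≤ 0 := by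
    intro x hx
    by_contra! hcon
    obtain ⟨y, hy, hy'⟩ := exists_hasDerivAt_eq_slope (deriv o) (deriv (deriv o)) hx.1
      (fun z hz => (ho' (hI ⟨hz.1, hz.2.trans hx.2.le⟩)).continuousAt.continuousWithinAt)
      (fun z hz => ho' (hI ⟨hz.1.le, (hz.2.trans hx.2).le⟩))
    have hxp := hpos x ⟨hx.1, by linarith [hx.2]⟩
    have hyp := hpos y ⟨hy.1, by linarith [hx.2, hy.2]⟩
    have h2 := hK ⟨hy.1, (hy.2.trans hx.2).le⟩ ⟨hx.1, hx.2.le⟩ hy.2.le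
    have h3 : -deriv (deriv o) x / o x < 0 := div_neg_of_neg_of_pos (by linarith) hxp
    have h4 : 0 < deriv (deriv o) y := by
      by_contra! h5
      have : 0 ≤ -deriv (deriv o) y / o y := div_nonneg (by linarith) hyp.le
      simp only at h2
      linarith
    rw [hy', h1, sub_zero] at h4
    have h6 := (div_pos_iff_of_pos_right hx.1).1 h4
    have h7 := (abs_lt.1 (hd x ⟨hx.1, by linarith [hx.2]⟩)).2
    linarith
  have hanti : AntitoneOn (deriv o) (Icc 0 (ℓ / 2)) := by
    refine antitoneOn_of_deriv_nonpos (convex_Icc _ _)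
      (fun x hx => (ho' (hI hx)).continuousAt.continuousWithinAt) (fun x hx => ?_) fun x hx => ?_
    · rw [interior_Icc] at hx
      exact (ho' (hI (Ioo_subset_Icc_self hx))).differentiableAt.differentiableWithinAt
    · rw [interior_Icc] at hx
      exact hneg x hx
  have hnn : ∀ x ∈ Icc 0 (ℓ / 2), 0 ≤ o x := by
    intro x hx
    rcases eq_or_lt_of_le hx.1 with rfl | hx'
    · exact h0.ge
    · exact (hpos x ⟨hx', by linarith [hx.2]⟩).le
  have hmono : MonotoneOn o (Icc 0 (ℓ / 2)) := by
    refine monotoneOn_of_deriv_nonneg (convex_Icc _ _)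
      (fun x hx => (ho (hI hx)).continuousAt.continuousWithinAt) (fun x hx => ?_) fun x hx => ?_
    · rw [interior_Icc] at hx
      exact (ho (hI (Ioo_subset_Icc_self hx))).differentiableAt.differentiableWithinAt
    · rw [interior_Icc] at hx
      rw [← hmid]
      exact hanti (Ioo_subset_Icc_self hx) ⟨by linarith, le_rfl⟩ hx.2.le
  have hGmono : MonotoneOn G (Icc 0 (ℓ / 2)) := by
    refine monotoneOn_of_deriv_nonneg (convex_Icc _ _)
      (fun x hx => (hG x (hI hx)).continuousAt.continuousWithinAt) (fun x hx => ?_) fun x hx => ?_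
    · rw [interior_Icc] at hx
      exact (hG x (hI (Ioo_subset_Icc_self hx))).differentiableAt.differentiableWithinAt
    · rw [interior_Icc] at hx
      rw [(hG x (hI (Ioo_subset_Icc_self hx))).deriv]
      exact hnn x (Ioo_subset_Icc_self hx)
  set f : ℝ → ℝ := fun x => deriv o x + G x - 1 with hf
  have hfd : ∀ x ∈ Ioo (-ℓ) ℓ, HasDerivAt f (deriv (deriv o) x + o x) x := fun x hx =>
    ((ho' hx).add (hG x hx)).sub_const 1
  have hf0 : f 0 = 0 := by simp [hf, h1, hG0]
  have hfm : f (ℓ / 2) = 0 := by simp [hf, hmid, hG1]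
  -- A negative value of f would give y < w with f'(y) < 0 < f'(w), that is, K(y) > 1 > K(w).
  have hfnn : ∀ x ∈ Icc 0 (ℓ / 2), 0 ≤ f x := by
    intro x hx
    by_contra! hcon
    have hx0 : 0 < x := lt_of_le_of_ne hx.1 (by rintro rfl; exact hcon.ne hf0)
    have hx1 : x < ℓ / 2 := lt_of_le_of_ne hx.2 (by rintro rfl; exact hcon.ne hfm)
    obtain ⟨y, hy, hy'⟩ := exists_hasDerivAt_eq_slope f (fun x => deriv (deriv o) x + o x) hx0
      (fun z hz => (hfd z (hI ⟨hz.1, hz.2.trans hx.2⟩)).continuousAt.continuousWithinAt)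
      (fun z hz => hfd z (hI ⟨hz.1.le, hz.2.le.trans hx.2⟩))
    obtain ⟨w, hw, hw'⟩ := exists_hasDerivAt_eq_slope f (fun x => deriv (deriv o) x + o x) hx1
      (fun z hz => (hfd z (hI ⟨hx.1.trans hz.1, hz.2⟩)).continuousAt.continuousWithinAt)
      (fun z hz => hfd z (hI ⟨hx.1.trans hz.1.le, hz.2.le⟩))
    have hyp := hpos y ⟨hy.1, by linarith [hx.2, hy.2]⟩
    have hwp := hpos w ⟨hx0.trans hw.1, by linarith [hw.2]⟩
    have h2 := hK (a := y) (b := w) ⟨hy.1, hy.2.le.trans hx.2⟩ ⟨hx0.trans hw.1, hw.2.le⟩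
      (hy.2.trans hw.1).le
    simp only at h2
    have h3 : deriv (deriv o) y + o y < 0 := by
      rw [hy', hf0]
      exact div_neg_of_neg_of_pos (by linarith) (by linarith)
    have h4 : 0 < deriv (deriv o) w + o w := by
      rw [hw', hfm]
      exact div_pos (by linarith) (by linarith)
    have h5 : 1 < -deriv (deriv o) y / o y := by rw [lt_div_iff₀ hyp]; linarith
    have h6 : -deriv (deriv o) w / o w < 1 := by rw [div_lt_iff₀ hwp]; linarith
    linarith
  have hfle : ∀ x ∈ Icc 0 (ℓ / 2), f x ≤ o x := by
    intro x hx
    -- If o'(x) ≤ o(x), then G ≤ 1 gives f ≤ o' ≤ o. Otherwise o' - o is decreasing and positive at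
    -- x, hence positive on [0, x]; with o'' ≤ 0 this makes o - f nondecreasing there, starting from
    -- 0.
    rcases le_or_gt (deriv o x) (o x) with hle | hgt
    · have := hGmono hx ⟨by linarith, le_rfl⟩ hx.2
      simp only [hf]
      linarith
    · have hsub : Icc 0 x ⊆ Icc 0 (ℓ / 2) := Icc_subset_Icc_right hx.2
      have hh : ∀ y ∈ Icc 0 x, HasDerivAt (fun y => o y - f y)
          (deriv o y - (deriv (deriv o) y + o y)) y := fun y hy =>
        (ho (hI (hsub hy))).sub (hfd y (hI (hsub hy)))
      have hm : MonotoneOn (fun y => o y - f y) (Icc 0 x) := by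
        refine monotoneOn_of_deriv_nonneg (convex_Icc _ _)
          (fun y hy => (hh y hy).continuousAt.continuousWithinAt) (fun y hy => ?_) fun y hy => ?_
        · rw [interior_Icc] at hy
          exact (hh y (Ioo_subset_Icc_self hy)).differentiableAt.differentiableWithinAt
        · rw [interior_Icc] at hy
          have hy' := Ioo_subset_Icc_self hy
          rw [(hh y hy').deriv]
          have h2 := hanti (hsub hy') hx hy'.2
          have h3 := hmono (hsub hy') hx hy'.2
          have h4 := hneg y ⟨hy.1, hy.2.trans_le hx.2⟩
          linarith
      have := hm ⟨le_rfl, hx.1⟩ ⟨hx.1, le_rfl⟩ hx.1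
      simp only [hf0, h0] at this
      linarith
  have hhalf : ∀ x ∈ Icc 0 (ℓ / 2), |f x| ≤ o x := fun x hx => by
    rw [abs_of_nonneg (hfnn x hx)]
    exact hfle x hx
  change |f t| ≤ o t
  rcases le_or_gt t (ℓ / 2) with hle | hgt
  · exact hhalf t ⟨ht.1, hle⟩
  · have ht' : t ∈ Ioo 0 ℓ := ⟨by linarith, ht.2⟩
    have hGsymm := primitive_reflect hsymm hG hG1 ht'
    have h2 := hhalf (ℓ - t) ⟨by linarith [ht.2], by linarith⟩
    have h3 : f t = -f (ℓ - t) := by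
      simp only [hf, hdsymm t ht']
      linarith
    rw [h3, abs_neg, ← hsymm t ht']
    exact h2

end Estimate

/-! ## The profile function as a smooth odd function -/

section Iterates

variable {ℓ : ℝ}

theorem contDiffOn_iteratedDerivWithin_Icc (hℓ : 0 < ℓ) {f : ℝ → ℝ}
    (hf : ContDiffOn ℝ ∞ f (Icc 0 ℓ)) (n : ℕ) :
    ContDiffOn ℝ ∞ (iteratedDerivWithin n f (Icc 0 ℓ)) (Icc 0 ℓ) := by
  induction n with
  | zero => simpa using hf
  | succ n ih =>
    rw [iteratedDerivWithin_succ]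
    exact ((contDiffOn_infty_iff_derivWithin (uniqueDiffOn_Icc hℓ)).1 ih).2

theorem iterate_deriv_extend (hℓ : 0 < ℓ) {f : ℝ → ℝ} {ε : ℝ} (hf : ContDiffOn ℝ ∞ f (Icc 0 ℓ))
    (hk : ∀ k, iteratedDerivWithin k f (Icc 0 ℓ) 0
      = ε * (-1) ^ k * iteratedDerivWithin k f (Icc 0 ℓ) 0) (n : ℕ) :
    EqOn (deriv^[n] (extend ε f)) (extend (ε * (-1) ^ n) (iteratedDerivWithin n f (Icc 0 ℓ)))
      (Ioo (-ℓ) ℓ) := by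
  induction n with
  | zero =>
    intro r _
    simp
  | succ n ih =>
    intro r hr
    rw [Function.iterate_succ_apply']
    have h1 : deriv^[n] (extend ε f) =ᶠ[𝓝 r]
        extend (ε * (-1) ^ n) (iteratedDerivWithin n f (Icc 0 ℓ)) := by
      filter_upwards [isOpen_Ioo.mem_nhds hr] with x hx using ih hx
    have h2 := hk (n + 1)
    rw [iteratedDerivWithin_succ] at h2
    rw [h1.deriv_eq, (hasDerivAt_extend (contDiffOn_iteratedDerivWithin_Icc hℓ hf n) (hk n)
      (by linear_combination h2) hr).deriv, ← iteratedDerivWithin_succ]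
    congr 1
    ring

end Iterates

/-! ### Reflection symmetry and the radial data of the profile -/

open scoped Pointwise in
theorem iteratedDerivWithin_reflect {ℓ : ℝ} {γ : ℝ → ℝ} (hsymm : ∀ t ∈ Icc 0 ℓ, γ t = γ (ℓ - t))
    (n : ℕ) {t : ℝ} (ht : t ∈ Icc 0 ℓ) :
    iteratedDerivWithin n γ (Icc 0 ℓ) (ℓ - t)
      = (-1) ^ n * iteratedDerivWithin n γ (Icc 0 ℓ) t := by
  have h1 : iteratedDerivWithin n γ (Icc 0 ℓ) t
      = iteratedDerivWithin n (fun x => γ (ℓ - x)) (Icc 0 ℓ) t :=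
    iteratedDerivWithin_congr (fun x hx => hsymm x hx) ht
  rw [iteratedDerivWithin_comp_const_sub] at h1
  have h2 : ℓ +ᵥ -Icc 0 ℓ = Icc 0 ℓ := by
    ext x
    rw [mem_vadd_set_iff_neg_vadd_mem]
    simp
  rw [h2] at h1
  simp only [h1, smul_eq_mul]
  rw [← mul_assoc, ← mul_pow]
  norm_num

theorem curvature_reflect {ℓ : ℝ} {γ : ℝ → ℝ} (hsymm : ∀ t ∈ Icc 0 ℓ, γ t = γ (ℓ - t))
    {t : ℝ} (ht : t ∈ Icc 0 ℓ) : curvature ℓ γ (ℓ - t) = curvature ℓ γ t := by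
  have hmem : ℓ - t ∈ Ioo 0 ℓ ↔ t ∈ Ioo 0 ℓ := by
    constructor <;> rintro ⟨h, h'⟩ <;> constructor <;> linarith
  have h1 := iteratedDerivWithin_reflect hsymm 1 ht
  rw [iteratedDerivWithin_one] at h1
  unfold curvature
  rw [iteratedDerivWithin_reflect hsymm 2 ht, iteratedDerivWithin_reflect hsymm 3 ht,
    ← hsymm t ht, h1]
  simp only [hmem]
  norm_num [pow_succ, neg_div, div_neg]

/-- The coefficient of the Levi-Civita connection form in terms of the function `k` with
`γ r = r + r ^ 3 * k r`. -/
def connCoeff (k : ℝ → ℝ) (r : ℝ) : ℝ := r * deriv k r + 3 * k r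

/-- The data that describe the metric of a symmetric profile function and the potential of its
area form in either chart: `γ r = r + r ^ 3 * k r` and `∫ t in 0..r, γ t = r ^ 2 * q r`. -/
structure RadialData (ℓ : ℝ) (γ k q : ℝ → ℝ) : Prop where
  smooth_k : ContDiffOn ℝ ∞ k (Ioo (-ℓ) ℓ)
  even_k : ∀ r, k (-r) = k r
  smooth_q : ContDiffOn ℝ ∞ q (Ioo (-ℓ) ℓ)
  even_q : ∀ r, q (-r) = q r
  profile : ∀ r ∈ Ico 0 ℓ, γ r = r * (1 + r ^ 2 * k r)
  symm : ∀ r ∈ Icc 0 ℓ, γ r = γ (ℓ - r)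
  pos : ∀ r ∈ Ico 0 ℓ, 0 < 1 + r ^ 2 * k r
  deriv_q : ∀ r ∈ Ioo (-ℓ) ℓ, r * deriv q r + 2 * q r = 1 + r ^ 2 * k r
  curvature_eq : ∀ r ∈ Ico 0 ℓ, curvature ℓ γ r * (1 + r ^ 2 * k r)
    = -(r * deriv (connCoeff k) r + 2 * connCoeff k r)
  bound : ∀ r ∈ Ico 0 ℓ, |connCoeff k r + q r| * r ≤ 1 + r ^ 2 * k r
  glue_q : ∀ r ∈ Ioo 0 ℓ, r ^ 2 * q r + (ℓ - r) ^ 2 * q (ℓ - r) = 2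
  glue_conn : ∀ r ∈ Ioo 0 ℓ, r ^ 2 * connCoeff k r + (ℓ - r) ^ 2 * connCoeff k (ℓ - r) = -2

theorem contDiffOn_connCoeff {a : ℝ} {k : ℝ → ℝ} (hk : ContDiffOn ℝ ∞ k (Ioo (-a) a)) :
    ContDiffOn ℝ ∞ (connCoeff k) (Ioo (-a) a) :=
  (contDiffOn_id.mul (deriv_contDiffOn hk)).add (contDiffOn_const.mul hk)

theorem connCoeff_even {k : ℝ → ℝ} (hk : ∀ r, k (-r) = k r) (r : ℝ) :
    connCoeff k (-r) = connCoeff k r := by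
  simp only [connCoeff, hk, deriv_even hk]
  ring

theorem integral_half {ℓ : ℝ} {γ : ℝ → ℝ} (hγ : IsNormalisedProfile ℓ γ)
    (hsymm : ∀ t ∈ Icc 0 ℓ, γ t = γ (ℓ - t)) : ∫ t in (0 : ℝ)..(ℓ / 2), γ t = 1 := by
  have hℓ := hγ.length_pos
  have hI : ∀ a b : ℝ, 0 ≤ a → a ≤ b → b ≤ ℓ → IntervalIntegrable γ volume a b := by
    intro a b ha hab hb
    refine (hγ.smooth.continuousOn.mono ?_).intervalIntegrable
    rw [uIcc_of_le hab]
    exact Icc_subset_Icc ha hb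
  have h1 := intervalIntegral.integral_add_adjacent_intervals
    (hI 0 (ℓ / 2) le_rfl (by linarith) (by linarith))
    (hI (ℓ / 2) ℓ (by linarith) (by linarith) le_rfl)
  have h2 : ∫ t in (0 : ℝ)..(ℓ / 2), γ (ℓ - t) = ∫ t in (ℓ / 2)..ℓ, γ t := by
    rw [intervalIntegral.integral_comp_sub_left, sub_half, sub_zero]
  have h3 : ∫ t in (0 : ℝ)..(ℓ / 2), γ t = ∫ t in (0 : ℝ)..(ℓ / 2), γ (ℓ - t) := by
    refine intervalIntegral.integral_congr fun t ht => ?_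
    rw [uIcc_of_le (by linarith)] at ht
    exact hsymm t ⟨ht.1, by linarith [ht.2]⟩
  rw [hγ.integral_eq] at h1
  linarith

theorem exists_radialData {ℓ : ℝ} {γ : ℝ → ℝ} (hγ : IsNormalisedProfile ℓ γ)
    (hsymm : ∀ t ∈ Icc 0 ℓ, γ t = γ (ℓ - t)) (hK : MonotoneOn (curvature ℓ γ) (Icc 0 (ℓ / 2))) :
    ∃ k q, RadialData ℓ γ k q := by
  have hℓ := hγ.length_pos
  have hk : ∀ k, iteratedDerivWithin k γ (Icc 0 ℓ) 0
      = -1 * (-1) ^ k * iteratedDerivWithin k γ (Icc 0 ℓ) 0 := by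
    intro k
    rcases Nat.even_or_odd k with hk | hk
    · obtain ⟨j, rfl⟩ := even_iff_exists_two_mul.1 hk
      rw [hγ.even_left j, mul_zero]
    · rw [hk.neg_one_pow]
      ring
  set o := extend (-1) γ with ho
  have hos : ContDiffOn ℝ ∞ o (Ioo (-ℓ) ℓ) :=
    contDiffOn_infty.2 fun n => contDiffOn_extend hℓ n hγ.smooth hk
  have hodd : ∀ r, o (-r) = -o r := by
    intro r
    rcases lt_trichotomy r 0 with hr | rfl | hr
    · rw [ho, extend_of_neg _ _ hr, extend_of_nonneg _ _ (by linarith)]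
      ring
    · rw [neg_zero, ho, extend_of_nonneg _ _ le_rfl, hγ.zero_left, neg_zero]
    · rw [ho, extend_of_nonneg _ _ hr.le, extend_of_neg _ _ (by linarith), neg_neg]
      ring
  have hoγ : ∀ r, 0 ≤ r → o r = γ r := fun r hr => extend_of_nonneg _ _ hr
  have hiter : ∀ n, ∀ r ∈ Ico 0 ℓ, deriv^[n] o r = iteratedDerivWithin n γ (Icc 0 ℓ) r := by
    intro n r hr
    rw [iterate_deriv_extend hℓ hγ.smooth hk n ⟨by linarith [hr.1], hr.2⟩,
      extend_of_nonneg _ _ hr.1]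
  have hd1 : ∀ r ∈ Ico 0 ℓ, deriv o r = derivWithin γ (Icc 0 ℓ) r := fun r hr => by
    rw [← iteratedDerivWithin_one, ← hiter 1 r hr]; rfl
  have hd2 : ∀ r ∈ Ico 0 ℓ, deriv (deriv o) r = iteratedDerivWithin 2 γ (Icc 0 ℓ) r :=
    fun r hr => by rw [← hiter 2 r hr]; rfl
  have hd3 : ∀ r ∈ Ico 0 ℓ, deriv (deriv (deriv o)) r = iteratedDerivWithin 3 γ (Icc 0 ℓ) r :=
    fun r hr => by rw [← hiter 3 r hr]; rfl
  have h0 : (0 : ℝ) ∈ Ico 0 ℓ := ⟨le_rfl, hℓ⟩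
  have ho1 : deriv o 0 = 1 := by rw [hd1 0 h0, hγ.deriv_left]
  -- The quotient o / r is even with value 1 at 0, so subtracting 1 and dividing by r² leaves a
  -- smooth even function.
  set k := divSq (dslope o 0) with hkdef
  have hpe : ∀ r, dslope o 0 (-r) = dslope o 0 r := dslope_odd hodd
  have hks : ContDiffOn ℝ ∞ k (Ioo (-ℓ) ℓ) := contDiffOn_divSq (contDiffOn_dslope hos)
  have hke : ∀ r, k (-r) = k r := divSq_even hpe
  have hok : ∀ r, o r = r * (1 + r ^ 2 * k r) := by
    intro r
    rw [eq_add_mul_dslope o r, odd_zero hodd, eq_add_sq_mul_divSq hpe r, dslope_same, ho1]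
    ring
  -- Thus κ = (γ' - 1) / r², and r² κ dφ is (γ' - 1) dφ written without a singularity at the pole.
  have hoκ : ∀ r ∈ Ioo (-ℓ) ℓ, deriv o r = 1 + r ^ 2 * connCoeff k r := by
    intro r hr
    have h1 := (hasDerivAt_id r).mul (((hasDerivAt_pow 2 r).mul
      (hasDerivAt_of_contDiffOn hks hr)).const_add 1)
    have h2 : o = id * fun r => 1 + (fun r => r ^ 2) r * k r := funext hok
    rw [h2]
    refine h1.deriv.trans ?_
    simp [connCoeff]
    ring
  set κ := connCoeff k with hκ
  have hκs : ContDiffOn ℝ ∞ κ (Ioo (-ℓ) ℓ) := contDiffOn_connCoeff hks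
  have hoc : ∀ r ∈ Ioo (-ℓ) ℓ, deriv (deriv o) r = r * (r * deriv κ r + 2 * κ r) := by
    intro r hr
    have h1 := ((hasDerivAt_pow 2 r).mul (hasDerivAt_of_contDiffOn hκs hr)).const_add 1
    have h2 : deriv o =ᶠ[𝓝 r] fun r => 1 + (fun r => r ^ 2) r * κ r := by
      filter_upwards [isOpen_Ioo.mem_nhds hr] with x hx using hoκ x hx
    rw [h2.deriv_eq]
    refine h1.deriv.trans ?_
    simp
    ring
  have h0' : (0 : ℝ) ∈ Ioo (-ℓ) ℓ := ⟨by linarith, hℓ⟩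
  have hoc0 : deriv (deriv (deriv o)) 0 = 2 * κ 0 := by
    have h1 := (hasDerivAt_id (0 : ℝ)).mul (((hasDerivAt_id (0 : ℝ)).mul
      (hasDerivAt_of_contDiffOn (deriv_contDiffOn hκs) h0')).add
        ((hasDerivAt_of_contDiffOn hκs h0').const_mul 2))
    have h2 : deriv (deriv o) =ᶠ[𝓝 0] id * (id * deriv κ + fun r => 2 * κ r) := by
      filter_upwards [isOpen_Ioo.mem_nhds h0'] with x hx using hoc x hx
    rw [h2.deriv_eq]
    refine h1.deriv.trans ?_
    simp
  set G : ℝ → ℝ := fun r => ∫ t in (0 : ℝ)..r, o t with hG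
  have hGd : ∀ r ∈ Ioo (-ℓ) ℓ, HasDerivAt G (o r) r := by
    intro r hr
    have hsub : uIcc 0 r ⊆ Ioo (-ℓ) ℓ := ordConnected_Ioo.uIcc_subset h0' hr
    exact intervalIntegral.integral_hasDerivAt_right
      (hos.continuousOn.mono hsub).intervalIntegrable
      (hos.continuousOn.stronglyMeasurableAtFilter isOpen_Ioo r hr)
      (hos.continuousOn.continuousAt (isOpen_Ioo.mem_nhds hr))
  have hG0 : G 0 = 0 := by simp [hG]
  have hG1 : G (ℓ / 2) = 1 := by
    rw [← integral_half hγ hsymm]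
    refine intervalIntegral.integral_congr fun t ht => ?_
    rw [uIcc_of_le (by linarith)] at ht
    exact hoγ t ht.1
  have hGe : ∀ r, G (-r) = G r := by
    intro r
    have h1 := intervalIntegral.integral_comp_neg (f := o) (a := 0) (b := r)
    simp only [hodd, intervalIntegral.integral_neg, neg_zero] at h1
    simp only [hG]
    rw [intervalIntegral.integral_symm, ← h1, neg_neg]
  have hGs : ContDiffOn ℝ ∞ G (Ioo (-ℓ) ℓ) := by
    rw [contDiffOn_infty_iff_deriv_of_isOpen isOpen_Ioo]
    exact ⟨fun r hr => (hGd r hr).differentiableAt.differentiableWithinAt,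
      hos.congr fun r hr => (hGd r hr).deriv⟩
  have hGq : ∀ r, G r = r ^ 2 * divSq G r := fun r => by
    conv_lhs => rw [eq_add_sq_mul_divSq hGe r, hG0, zero_add]
  have hqs := contDiffOn_divSq hGs
  set q := divSq G with hq
  have hosymm : ∀ t ∈ Ioo 0 ℓ, o (ℓ - t) = o t := fun t ht => by
    rw [hoγ t ht.1.le, hoγ _ (by linarith [ht.2]), hsymm t ⟨ht.1.le, ht.2.le⟩]
  have hopos : ∀ t ∈ Ioo 0 ℓ, 0 < o t := fun t ht => by rw [hoγ t ht.1.le]; exact hγ.pos t ht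
  refine ⟨k, q, hks, hke, hqs, divSq_even hGe, fun r hr => ?_, hsymm, fun r hr => ?_,
    fun r hr => ?_, fun r hr => ?_, fun r hr => ?_, fun r hr => ?_, fun r hr => ?_⟩
  · rw [← hoγ r hr.1, hok]
  · rcases eq_or_lt_of_le hr.1 with rfl | hr0
    · simp
    · have := hopos r ⟨hr0, hr.2⟩
      rw [hok] at this
      exact (mul_pos_iff_of_pos_left hr0).1 this
  -- Differentiating G = r² q gives the identity only after multiplication by r; continuity removes
  -- this factor at 0.
  · refine eqOn_of_mul_eq (c := fun r => r * deriv q r + 2 * q r)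
      (d := fun r => 1 + r ^ 2 * k r) ?_ ?_ (fun r hr => ?_) hr
    · exact (continuousOn_id.mul (deriv_contDiffOn hqs).continuousOn).add
        (continuousOn_const.mul hqs.continuousOn)
    · exact continuousOn_const.add ((continuousOn_id.pow 2).mul hks.continuousOn)
    · have h1 := (hasDerivAt_pow 2 r).mul (hasDerivAt_of_contDiffOn hqs hr)
      have h2 : G = (fun r => r ^ 2) * q := funext hGq
      have h3 := hGd r hr
      rw [h2] at h3
      have h4 := h3.unique h1
      rw [hok] at h4
      rw [h4]
      simp
      ring
  · unfold curvature
    rcases eq_or_lt_of_le hr.1 with rfl | hr0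
    · rw [if_neg (by simp), ← hd3 0 h0, ← hd1 0 h0, ho1, hoc0]
      simp [hκ]
    · rw [if_pos ⟨hr0, hr.2⟩, ← hd2 r hr, hoc r ⟨by linarith, hr.2⟩, ← hoγ r hr.1,
        div_mul_eq_mul_div, div_eq_iff (hopos r ⟨hr0, hr.2⟩).ne', hok]
      ring
  · have hr' : r ∈ Ioo (-ℓ) ℓ := ⟨by linarith [hr.1], hr.2⟩
    rcases eq_or_lt_of_le hr.1 with rfl | hr0
    · simp
    · have h1 := abs_primitive_le (G := G) hos (odd_zero hodd) ho1 hopos (fun t ht => by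
          rw [hd1 t ⟨ht.1.le, ht.2⟩]; exact hγ.abs_deriv_lt t ht) hosymm
        (by
          refine MonotoneOn.congr (hK.mono Ioc_subset_Icc_self) fun t ht => ?_
          have ht' : t ∈ Ioo 0 ℓ := ⟨ht.1, by linarith [ht.2]⟩
          rw [curvature, if_pos ht', hd2 t ⟨ht'.1.le, ht'.2⟩, hoγ t ht'.1.le]) hGd hG0 hG1 hr
      rw [hoκ r hr', hGq, hok] at h1
      have h2 : 1 + r ^ 2 * κ r + r ^ 2 * q r - 1 = r * ((κ r + q r) * r) := by ring
      rw [h2, abs_mul, abs_mul, abs_of_pos hr0] at h1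
      exact le_of_mul_le_mul_left h1 hr0
  · rw [← hGq, ← hGq]
    exact primitive_reflect hosymm hGd hG1 hr
  · have h1 := hoκ r ⟨by linarith [hr.1], hr.2⟩
    have h2 := hoκ (ℓ - r) ⟨by linarith [hr.2], by linarith [hr.1]⟩
    rw [deriv_reflect hosymm hr] at h2
    linarith

/-! ## The orthonormal frame and the metric -/

/-- The linear isomorphism from the tangent plane at `z` onto `ℂ` that is an isometry for the
metric. -/
def frame (k : ℝ → ℝ) (z : ℂ) : ℂ →L[ℝ] ℂ :=
  ContinuousLinearMap.id ℝ ℂ + k ‖z‖ • (rot z).smulRight (I * z)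

theorem frame_apply (k : ℝ → ℝ) (z v : ℂ) :
    frame k z v = v + (k ‖z‖ * rot z v : ℝ) * (I * z) := by
  simp [frame, mul_assoc]

theorem frame_re (k : ℝ → ℝ) (z v : ℂ) :
    (frame k z v).re = v.re - k ‖z‖ * rot z v * z.im := by
  rw [frame_apply]
  simp
  ring

theorem frame_im (k : ℝ → ℝ) (z v : ℂ) :
    (frame k z v).im = v.im + k ‖z‖ * rot z v * z.re := by
  rw [frame_apply]
  simp

/-- Since `rot z v` is the inner product of v with iz, the frame fixes the radial direction and
stretches iz by 1 + r² k = γ / r, which is its determinant. -/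
theorem cross_frame (k : ℝ → ℝ) (z u v : ℂ) :
    (frame k z u).re * (frame k z v).im - (frame k z u).im * (frame k z v).re
      = (1 + ‖z‖ ^ 2 * k ‖z‖) * (u.re * v.im - u.im * v.re) := by
  rw [frame_re, frame_im, frame_re, frame_im, norm_sq_eq]
  simp only [rot_apply]
  ring

theorem rot_frame (k : ℝ → ℝ) (z v : ℂ) :
    rot z (frame k z v) = (1 + ‖z‖ ^ 2 * k ‖z‖) * rot z v := by
  rw [rot_apply, frame_re, frame_im, norm_sq_eq]
  simp only [rot_apply]
  ring

theorem contDiff_smulRight_rot : ContDiff ℝ ∞ fun z : ℂ => (rot z).smulRight (I * z) := by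
  have h := (ContinuousLinearMap.smulRightL ℝ ℂ ℂ).isBoundedBilinearMap.contDiff (n := ∞)
  exact h.comp (contDiff_rot.prodMk (contDiff_const.mul contDiff_id))

section Metric

variable {ℓ : ℝ} {γ k q : ℝ → ℝ}

theorem norm_mem_Ico {z : ℂ} (hz : z ∈ disc ℓ) : ‖z‖ ∈ Ico 0 ℓ :=
  ⟨norm_nonneg z, mem_ball_zero_iff.1 hz⟩

theorem RadialData.profile_lat (h : RadialData ℓ γ k q) (i : Pole) {z : ℂ} (hz : z ∈ disc ℓ) :
    γ (lat ℓ i z) = ‖z‖ * (1 + ‖z‖ ^ 2 * k ‖z‖) := by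
  have hr := norm_mem_Ico hz
  rw [← h.profile _ hr]
  cases i
  · rfl
  · exact (h.symm _ ⟨hr.1, hr.2.le⟩).symm

theorem RadialData.metric_eq (h : RadialData ℓ γ k q) (i : Pole) {z : ℂ} (hz : z ∈ disc ℓ)
    (u v : ℂ) : metric ℓ γ i z u v
      = (frame k z u).re * (frame k z v).re + (frame k z u).im * (frame k z v).im := by
  rcases eq_or_ne z 0 with rfl | hz0
  · simp [metric, frame_re, frame_im]
  · have hn : ‖z‖ ≠ 0 := norm_ne_zero_iff.2 hz0
    have h1 : metric ℓ γ i z u v = (‖z‖ ^ 2)⁻¹ * (dotL z u * dotL z v)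
        + (1 + ‖z‖ ^ 2 * k ‖z‖) ^ 2 * ((‖z‖ ^ 2)⁻¹ * (rot z u * rot z v)) := by
      rw [metric, if_neg hz0, h.profile_lat i hz]
      simp [dr, dphi]
      field_simp
    rw [h1, frame_re, frame_im, frame_re, frame_im]
    simp only [dotL_apply, rot_apply]
    have h2 := norm_sq_eq z
    generalize hN : ‖z‖ ^ 2 = N at *
    have hN0 : N ≠ 0 := by rw [← hN]; positivity
    generalize k ‖z‖ = K
    field_simp
    rw [h2]
    ring

theorem RadialData.metric_self (h : RadialData ℓ γ k q) (i : Pole) {z : ℂ} (hz : z ∈ disc ℓ)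
    (v : ℂ) : metric ℓ γ i z v v = ‖frame k z v‖ ^ 2 := by
  rw [h.metric_eq i hz, norm_sq_eq]
  ring

theorem RadialData.area_eq (h : RadialData ℓ γ k q) (i : Pole) {z : ℂ} (hz : z ∈ disc ℓ)
    (u v : ℂ) : area ℓ γ i z u v
      = (1 + ‖z‖ ^ 2 * k ‖z‖) * (u.re * v.im - u.im * v.re) := by
  have hp := h.pos _ (norm_mem_Ico hz)
  have h1 : metric ℓ γ i z 1 1 * metric ℓ γ i z I I - metric ℓ γ i z 1 I ^ 2
      = (1 + ‖z‖ ^ 2 * k ‖z‖) ^ 2 := by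
    have h2 := cross_frame k z 1 I
    simp only [one_re, I_im, one_im, I_re] at h2
    rw [h.metric_eq i hz, h.metric_eq i hz, h.metric_eq i hz]
    linear_combination (((frame k z 1).re * (frame k z I).im
      - (frame k z 1).im * (frame k z I).re) + (1 + ‖z‖ ^ 2 * k ‖z‖)) * h2
  rw [area, h1, Real.sqrt_sq hp.le]

theorem RadialData.frame_ne_zero (h : RadialData ℓ γ k q) {z v : ℂ} (hz : z ∈ disc ℓ)
    (hv : v ≠ 0) : frame k z v ≠ 0 := by
  intro h0
  have hp := h.pos _ (norm_mem_Ico hz)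
  have h1 := rot_frame k z v
  rw [h0, map_zero] at h1
  have h2 : rot z v = 0 := (mul_eq_zero.1 h1.symm).resolve_left hp.ne'
  rw [frame_apply, h2] at h0
  simp at h0
  exact hv h0

/-- This is the pointwise bound |β(v)| ≤ |v|. Cauchy–Schwarz for the framed vector bounds `rot z v`
by r |v| / (1 + r² k), and `RadialData.bound` absorbs the quotient. -/
theorem RadialData.abs_rot_le (h : RadialData ℓ γ k q) {z : ℂ} (hz : z ∈ disc ℓ) (v : ℂ) :
    |(connCoeff k ‖z‖ + q ‖z‖) * rot z v| ≤ ‖frame k z v‖ := by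
  have hp := h.pos _ (norm_mem_Ico hz)
  have hb := h.bound _ (norm_mem_Ico hz)
  have h1 : |rot z (frame k z v)| ≤ ‖z‖ * ‖frame k z v‖ := by
    rw [← abs_of_nonneg (by positivity : 0 ≤ ‖z‖ * ‖frame k z v‖), ← sq_le_sq, mul_pow,
      norm_sq_eq, norm_sq_eq, rot_apply]
    nlinarith [sq_nonneg (z.re * (frame k z v).re + z.im * (frame k z v).im)]
  rw [rot_frame, abs_mul, abs_of_pos hp] at h1
  rw [abs_mul]
  set p := 1 + ‖z‖ ^ 2 * k ‖z‖
  refine le_of_mul_le_mul_left ?_ hp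
  calc p * (|connCoeff k ‖z‖ + q ‖z‖| * |rot z v|)
      = |connCoeff k ‖z‖ + q ‖z‖| * (p * |rot z v|) := by ring
    _ ≤ |connCoeff k ‖z‖ + q ‖z‖| * (‖z‖ * ‖frame k z v‖) := by gcongr
    _ = (|connCoeff k ‖z‖ + q ‖z‖| * ‖z‖) * ‖frame k z v‖ := by ring
    _ ≤ p * ‖frame k z v‖ := by gcongr

theorem RadialData.contDiffOn_frame (h : RadialData ℓ γ k q) :
    ContDiffOn ℝ ∞ (frame k) (disc ℓ) :=
  contDiffOn_const.add ((contDiffOn_radial h.smooth_k h.even_k).smul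
    contDiff_smulRight_rot.contDiffOn)

end Metric

/-! ## One-forms -/

section OneForms

variable {E : Type*} [NormedAddCommGroup E] [NormedSpace ℝ E]

/-- A continuous linear form as an alternating form of degree one. -/
abbrev toAlt (f : E →L[ℝ] ℝ) : E [⋀^Fin 1]→L[ℝ] ℝ :=
  ContinuousAlternatingMap.ofSubsingleton ℝ E ℝ (0 : Fin 1) f

theorem contDiffOn_toAlt {b : E → E →L[ℝ] ℝ} {s : Set E} (hb : ContDiffOn ℝ ∞ b s) :
    ContDiffOn ℝ ∞ (fun x => toAlt (b x)) s :=
  (ContinuousAlternatingMap.ofSubsingletonLIE (𝕜 := ℝ) (E := E) (F := ℝ)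
    (0 : Fin 1)).contDiff.comp_contDiffOn hb

theorem differentiableAt_toAlt {b : E → E →L[ℝ] ℝ} {x : E} (hb : DifferentiableAt ℝ b x) :
    DifferentiableAt ℝ (fun x => toAlt (b x)) x :=
  ((ContinuousAlternatingMap.ofSubsingletonLIE (𝕜 := ℝ) (E := E) (F := ℝ)
    (0 : Fin 1)).differentiableAt).comp x hb

theorem extDeriv_toAlt {b : E → E →L[ℝ] ℝ} {x : E} (hb : DifferentiableAt ℝ b x) (u v : E) :
    extDeriv (fun x => toAlt (b x)) x ![u, v]
      = fderiv ℝ b x u v - fderiv ℝ b x v u := by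
  have h1 : ∀ w, HasFDerivAt (fun y => b y w) ((fderiv ℝ b x).flip w) x := fun w => by
    simpa using hb.hasFDerivAt.clm_apply (hasFDerivAt_const w x)
  rw [extDeriv_apply (differentiableAt_toAlt hb), Fin.sum_univ_two]
  have h2 : (fun y => toAlt (b y) ((0 : Fin 2).removeNth ![u, v])) = fun y => b y v := rfl
  have h3 : (fun y => toAlt (b y) ((1 : Fin 2).removeNth ![u, v])) = fun y => b y u := rfl
  rw [h2, h3, (h1 v).fderiv, (h1 u).fderiv]
  simp [sub_eq_add_neg]

theorem alt_ext_iff {a b : E [⋀^Fin 1]→L[ℝ] ℝ} : a = b ↔ ∀ v, a ![v] = b ![v] := by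
  refine ⟨fun h v => by rw [h], fun h => ContinuousAlternatingMap.ext fun m => ?_⟩
  have : m = ![m 0] := by
    ext i
    fin_cases i
    rfl
  rw [this]
  exact h _

end OneForms

/-! ### Rotationally invariant forms e(r) (x dy - y dx) -/

section Rotational

variable {a : ℝ} {e : ℝ → ℝ}

theorem contDiffOn_smul_rot (hs : ContDiffOn ℝ ∞ e (Ioo (-a) a)) (he : ∀ r, e (-r) = e r) :
    ContDiffOn ℝ ∞ (fun z => e ‖z‖ • rot z) (disc a) :=
  (contDiffOn_radial hs he).smul contDiff_rot.contDiffOn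

theorem fderiv_rot (z u v : ℂ) : fderiv ℝ rot z u v = u.re * v.im - u.im * v.re := by
  have h1 : HasFDerivAt rot (reCLM.smulRight imCLM - imCLM.smulRight reCLM) z :=
    (reCLM.hasFDerivAt.smul_const imCLM).sub (imCLM.hasFDerivAt.smul_const reCLM)
  rw [h1.fderiv]
  simp

theorem fderiv_smul_rot (hs : ContDiffOn ℝ ∞ e (Ioo (-a) a)) (he : ∀ r, e (-r) = e r) {z : ℂ}
    (hz : z ∈ disc a) (u v : ℂ) :
    fderiv ℝ (fun z => e ‖z‖ • rot z) z u v
      = derivDiv e ‖z‖ * dotL z u * rot z v + e ‖z‖ * (u.re * v.im - u.im * v.re) := by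
  have h1 : HasFDerivAt (fun z => e ‖z‖ • rot z) _ z := (hasFDerivAt_radial hs he hz).smul
    ((contDiff_rot.differentiable (by simp)) z).hasFDerivAt
  rw [h1.fderiv, ← fderiv_rot z u v]
  simp
  ring

/-- In polar coordinates the form is r² e dφ, and (r² e)' / r = r e' + 2 e. -/
theorem fderiv_smul_rot_sub (hs : ContDiffOn ℝ ∞ e (Ioo (-a) a)) (he : ∀ r, e (-r) = e r) {z : ℂ}
    (hz : z ∈ disc a) (u v : ℂ) :
    fderiv ℝ (fun z => e ‖z‖ • rot z) z u v - fderiv ℝ (fun z => e ‖z‖ • rot z) z v u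
      = (‖z‖ * deriv e ‖z‖ + 2 * e ‖z‖) * (u.re * v.im - u.im * v.re) := by
  rw [fderiv_smul_rot hs he hz, fderiv_smul_rot hs he hz, ← mul_derivDiv he, ← mul_assoc, ← sq,
    norm_sq_eq]
  simp only [dotL_apply, rot_apply]
  ring

end Rotational

/-! ## The primitive of `(1 - K) μ` -/

section Primitive

variable {ℓ : ℝ} {γ k q : ℝ → ℝ}

/-- The coefficient of the primitive of `(1 - K) μ`. -/
def primCoeff (k q : ℝ → ℝ) (r : ℝ) : ℝ := connCoeff k r + q r

/-- The primitive of `(1 - K) μ`, in either chart. -/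
def primForm (k q : ℝ → ℝ) (_ : Pole) (z : ℂ) : ℂ [⋀^Fin 1]→L[ℝ] ℝ :=
  toAlt (primCoeff k q ‖z‖ • rot z)

theorem hasFDerivAt_glue (ℓ : ℝ) {z : ℂ} (hz : z ≠ 0) :
    HasFDerivAt (glue ℓ) (((ℓ - ‖z‖) / ‖z‖) • (conjCLE : ℂ →L[ℝ] ℂ)
      - ((ℓ / ‖z‖ ^ 3) • dotL z).smulRight ((starRingEnd ℂ) z)) z := by
  have hn : ‖z‖ ≠ 0 := norm_ne_zero_iff.2 hz
  have h1 := (((hasDerivAt_const ‖z‖ ℓ).sub (hasDerivAt_id ‖z‖)).div (hasDerivAt_id ‖z‖)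
    hn).comp_hasFDerivAt z (hasFDerivAt_norm hz)
  have h2 := h1.smul (conjCLE : ℂ →L[ℝ] ℂ).hasFDerivAt
  refine (h2.congr_fderiv ?_)
  ext1 u
  have hn' : (‖z‖ : ℂ) ≠ 0 := by exact_mod_cast hn
  simp
  field_simp
  ring

theorem norm_glue {z : ℂ} (hz : z ∈ annulus ℓ) : ‖glue ℓ z‖ = ℓ - ‖z‖ := by
  have hn : 0 < ‖z‖ := norm_pos_iff.2 hz.2
  have := (norm_mem_Ico hz.1).2
  rw [glue, norm_smul, RCLike.norm_conj, Real.norm_of_nonneg (by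
    apply div_nonneg <;> linarith)]
  field_simp

theorem norm_mem_Ioo_of_annulus {z : ℂ} (hz : z ∈ annulus ℓ) : ‖z‖ ∈ Ioo 0 ℓ :=
  ⟨norm_pos_iff.2 hz.2, (norm_mem_Ico hz.1).2⟩

theorem glue_mem_annulus {z : ℂ} (hz : z ∈ annulus ℓ) : glue ℓ z ∈ annulus ℓ := by
  have h1 := norm_glue hz
  have h2 := norm_mem_Ioo_of_annulus hz
  refine ⟨mem_ball_zero_iff.2 (by linarith [h2.1]), ?_⟩
  rw [mem_singleton_iff, ← norm_eq_zero, h1]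
  linarith [h2.2]

theorem fderiv_glue_apply {z : ℂ} (hz : z ∈ annulus ℓ) (u : ℂ) :
    fderiv ℝ (glue ℓ) z u = (((ℓ - ‖z‖) / ‖z‖ : ℝ) : ℂ) * (starRingEnd ℂ) u
      - ((ℓ / ‖z‖ ^ 3 * dotL z u : ℝ) : ℂ) * (starRingEnd ℂ) z := by
  rw [(hasFDerivAt_glue ℓ hz.2).fderiv]
  simp

theorem rot_glue {z : ℂ} (hz : z ∈ annulus ℓ) (u : ℂ) :
    rot (glue ℓ z) (fderiv ℝ (glue ℓ) z u) = -((ℓ - ‖z‖) ^ 2 / ‖z‖ ^ 2 * rot z u) := by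
  have hn : ‖z‖ ≠ 0 := norm_ne_zero_iff.2 hz.2
  have h1 : (ℓ - ‖z‖) ^ 2 / ‖z‖ ^ 2 = ((ℓ - ‖z‖) / ‖z‖) ^ 2 := (div_pow _ _ _).symm
  rw [fderiv_glue_apply hz, glue, h1]
  generalize (ℓ - ‖z‖) / ‖z‖ = c
  generalize ℓ / ‖z‖ ^ 3 * dotL z u = d
  simp
  ring

/-- The transition map sends (r, φ) to (ℓ - r, -φ), so r² e dφ pulls back to -(ℓ - r)² e(ℓ - r) dφ.
The two local forms therefore differ by c dφ, and they glue exactly when c = 0. -/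
theorem smul_rot_glue {e : ℝ → ℝ} {c : ℝ}
    (he : ∀ r ∈ Ioo 0 ℓ, r ^ 2 * e r + (ℓ - r) ^ 2 * e (ℓ - r) = c) {z : ℂ}
    (hz : z ∈ annulus ℓ) (u : ℂ) :
    e ‖glue ℓ z‖ * rot (glue ℓ z) (fderiv ℝ (glue ℓ) z u)
      = e ‖z‖ * rot z u - c / ‖z‖ ^ 2 * rot z u := by
  have hn : ‖z‖ ≠ 0 := norm_ne_zero_iff.2 hz.2
  rw [rot_glue hz, norm_glue hz, ← he _ (norm_mem_Ioo_of_annulus hz)]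
  field_simp
  ring

theorem RadialData.contDiffOn_primCoeff (h : RadialData ℓ γ k q) :
    ContDiffOn ℝ ∞ (primCoeff k q) (Ioo (-ℓ) ℓ) :=
  (contDiffOn_connCoeff h.smooth_k).add h.smooth_q

theorem RadialData.primCoeff_even (h : RadialData ℓ γ k q) (r : ℝ) :
    primCoeff k q (-r) = primCoeff k q r := by
  rw [primCoeff, connCoeff_even h.even_k, h.even_q, primCoeff]

theorem RadialData.curvature_lat (h : RadialData ℓ γ k q) (i : Pole) {z : ℂ} (hz : z ∈ disc ℓ) :
    curvature ℓ γ (lat ℓ i z) = curvature ℓ γ ‖z‖ := by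
  have hr := norm_mem_Ico hz
  cases i
  · rfl
  · exact curvature_reflect h.symm ⟨hr.1, hr.2.le⟩

theorem RadialData.primForm_mem (h : RadialData ℓ γ k q) : primForm k q ∈ primitives ℓ γ := by
  have hsm := contDiffOn_smul_rot h.contDiffOn_primCoeff h.primCoeff_even
  refine ⟨⟨fun i => contDiffOn_toAlt hsm, fun i z hz => ?_⟩, fun i z hz u v => ?_⟩
  · rw [alt_ext_iff]
    intro v
    -- The defects 2 of the area potential and -2 of the connection coefficient cancel: this is
    -- Gauss–Bonnet for total area 4π.
    have h1 := smul_rot_glue (e := primCoeff k q) (c := 0) (fun r hr => by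
      simp only [primCoeff]
      linear_combination h.glue_q r hr + h.glue_conn r hr) hz v
    rw [zero_div, zero_mul, sub_zero] at h1
    exact h1.symm
  · have hd := (hsm.contDiffAt ((isOpen_disc ℓ).mem_nhds hz)).differentiableAt (by simp)
    have hr := norm_mem_Ico hz
    have hI := norm_mem_Ioo hz
    have h1 : deriv (primCoeff k q) ‖z‖ = deriv (connCoeff k) ‖z‖ + deriv q ‖z‖ :=
      ((hasDerivAt_of_contDiffOn (contDiffOn_connCoeff h.smooth_k) hI).add
        (hasDerivAt_of_contDiffOn h.smooth_q hI)).deriv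
    refine (extDeriv_toAlt hd u v).trans ?_
    rw [fderiv_smul_rot_sub h.contDiffOn_primCoeff h.primCoeff_even hz, h.area_eq i hz,
      h.curvature_lat i hz, ← mul_assoc, sub_mul, h.curvature_eq _ hr, h1, primCoeff]
    linear_combination (u.re * v.im - u.im * v.re) * h.deriv_q _ hI

theorem RadialData.mGamma_le_one (h : RadialData ℓ γ k q) : mGamma ℓ γ ≤ 1 := by
  refine (iInf₂_le _ h.primForm_mem).trans ?_
  refine iSup_le fun i => iSup_le fun z => iSup_le fun hz => iSup_le fun v => iSup_le fun hv => ?_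
  rw [ENNReal.ofReal_le_one]
  refine (h.abs_rot_le hz v).trans ?_
  rw [h.metric_self i hz] at hv
  nlinarith [norm_nonneg (frame k z v)]

end Primitive

/-! ## The contact form -/

section Contact

variable {ℓ : ℝ} {γ k q : ℝ → ℝ}

/-- The components of a tangent vector in the orthonormal frame. -/
def frameMap (k : ℝ → ℝ) (p : ℂ × ℂ) : ℂ := frame k p.1 p.2

/-- The differential of the angle of a tangent vector in the orthonormal frame. -/
def angForm (k : ℝ → ℝ) (p : ℂ × ℂ) : ℂ × ℂ →L[ℝ] ℝ :=
  imCLM.comp ((frameMap k p)⁻¹ • fderiv ℝ (frameMap k) p)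

/-- The pull-back to the tangent bundle of a rotationally invariant primitive of the area form. -/
def potForm (q : ℝ → ℝ) (p : ℂ × ℂ) : ℂ × ℂ →L[ℝ] ℝ :=
  (q ‖p.1‖ • rot p.1).comp (ContinuousLinearMap.fst ℝ ℂ ℂ)

/-- The Liouville form in terms of the orthonormal frame. -/
def liouvilleL (k : ℝ → ℝ) (p : ℂ × ℂ) : ℂ × ℂ →L[ℝ] ℝ :=
  ((frameMap k p).re • reCLM + (frameMap k p).im • imCLM).comp
    ((frame k p.1).comp (ContinuousLinearMap.fst ℝ ℂ ℂ))

/-- The primitive of the magnetic form. -/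
def contactForm (ℓ : ℝ) (γ k q : ℝ → ℝ) (s : ℝ) (i : Pole) (p : ℂ × ℂ) :
    (ℂ × ℂ) [⋀^Fin 1]→L[ℝ] ℝ :=
  liouville ℓ γ i p + s • toAlt (angForm k p - potForm q p)

theorem angForm_apply (k : ℝ → ℝ) (p ξ : ℂ × ℂ) :
    angForm k p ξ = ((frameMap k p)⁻¹ * fderiv ℝ (frameMap k) p ξ).im := by
  simp [angForm]

theorem potForm_apply (q : ℝ → ℝ) (p ξ : ℂ × ℂ) : potForm q p ξ = q ‖p.1‖ * rot p.1 ξ.1 := rfl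

theorem liouvilleL_apply (k : ℝ → ℝ) (p ξ : ℂ × ℂ) :
    liouvilleL k p ξ = (frameMap k p).re * (frame k p.1 ξ.1).re
      + (frameMap k p).im * (frame k p.1 ξ.1).im := rfl

theorem RadialData.liouville_eq (h : RadialData ℓ γ k q) (i : Pole) {p : ℂ × ℂ}
    (hp : p.1 ∈ disc ℓ) : liouville ℓ γ i p = toAlt (liouvilleL k p) := by
  rw [alt_ext_iff]
  intro ξ
  exact h.metric_eq i hp p.2 ξ.1

theorem isOpen_disc_prod (ℓ : ℝ) : IsOpen (disc ℓ ×ˢ (univ : Set ℂ)) :=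
  (isOpen_disc ℓ).prod isOpen_univ

theorem tdisc_subset (ℓ : ℝ) : tdisc ℓ ⊆ disc ℓ ×ˢ univ := prod_mono_right (subset_univ _)

theorem isOpen_tdisc (ℓ : ℝ) : IsOpen (tdisc ℓ) := (isOpen_disc ℓ).prod isOpen_compl_singleton

theorem RadialData.contDiffOn_frame_fst (h : RadialData ℓ γ k q) :
    ContDiffOn ℝ ∞ (fun p : ℂ × ℂ => frame k p.1) (disc ℓ ×ˢ univ) :=
  h.contDiffOn_frame.comp contDiff_fst.contDiffOn fun _ hp => hp.1

theorem RadialData.contDiffOn_frameMap (h : RadialData ℓ γ k q) :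
    ContDiffOn ℝ ∞ (frameMap k) (disc ℓ ×ˢ univ) :=
  h.contDiffOn_frame_fst.clm_apply contDiff_snd.contDiffOn

theorem RadialData.contDiffOn_liouvilleL (h : RadialData ℓ γ k q) :
    ContDiffOn ℝ ∞ (liouvilleL k) (disc ℓ ×ˢ univ) := by
  refine ContDiffOn.clm_comp (ContDiffOn.add ?_ ?_) (h.contDiffOn_frame_fst.clm_comp
    contDiffOn_const)
  · exact (reCLM.contDiff.comp_contDiffOn h.contDiffOn_frameMap).smul contDiffOn_const
  · exact (imCLM.contDiff.comp_contDiffOn h.contDiffOn_frameMap).smul contDiffOn_const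

theorem RadialData.contDiffOn_potForm (h : RadialData ℓ γ k q) :
    ContDiffOn ℝ ∞ (potForm q) (disc ℓ ×ˢ univ) :=
  ((contDiffOn_smul_rot h.smooth_q h.even_q).comp contDiff_fst.contDiffOn
    fun _ hp => hp.1).clm_comp contDiffOn_const

theorem RadialData.contDiffOn_angForm (h : RadialData ℓ γ k q) :
    ContDiffOn ℝ ∞ (angForm k) (tdisc ℓ) := by
  refine contDiffOn_const.clm_comp (ContDiffOn.smul (ContDiffOn.inv
    (h.contDiffOn_frameMap.mono (tdisc_subset ℓ)) fun p hp => h.frame_ne_zero hp.1 hp.2) ?_)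
  exact (h.contDiffOn_frameMap.fderiv_of_isOpen (isOpen_disc_prod ℓ) (m := ∞)
    (by simp)).mono (tdisc_subset ℓ)

theorem RadialData.contDiffOn_contactForm (h : RadialData ℓ γ k q) (s : ℝ) (i : Pole) :
    ContDiffOn ℝ ∞ (contactForm ℓ γ k q s i) (tdisc ℓ) := by
  refine ContDiffOn.add ?_ ((contDiffOn_toAlt
    (h.contDiffOn_angForm.sub (h.contDiffOn_potForm.mono (tdisc_subset ℓ)))).const_smul s)
  exact (contDiffOn_toAlt (h.contDiffOn_liouvilleL.mono (tdisc_subset ℓ))).congr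
    fun p hp => h.liouville_eq i hp.1

theorem RadialData.fderiv_frame (h : RadialData ℓ γ k q) {z : ℂ} (hz : z ∈ disc ℓ) (u v : ℂ) :
    fderiv ℝ (frame k) z u v = ((fderiv ℝ (fun z => k ‖z‖ • rot z) z u v : ℝ) : ℂ) * (I * z)
      + ((k ‖z‖ * rot z v : ℝ) : ℂ) * (I * u) := by
  have hd : DifferentiableAt ℝ (frame k) z :=
    (h.contDiffOn_frame.contDiffAt ((isOpen_disc ℓ).mem_nhds hz)).differentiableAt (by simp)
  have hb : DifferentiableAt ℝ (fun z => k ‖z‖ • rot z) z :=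
    ((contDiffOn_smul_rot h.smooth_k h.even_k).contDiffAt
      ((isOpen_disc ℓ).mem_nhds hz)).differentiableAt (by simp)
  have h1 : HasFDerivAt (fun z => frame k z v) ((fderiv ℝ (frame k) z).flip v) z := by
    simpa using hd.hasFDerivAt.clm_apply (hasFDerivAt_const v z)
  have h2 : HasFDerivAt (fun z => (k ‖z‖ • rot z) v)
      ((fderiv ℝ (fun z => k ‖z‖ • rot z) z).flip v) z := by
    simpa using hb.hasFDerivAt.clm_apply (hasFDerivAt_const v z)
  have h3 : HasFDerivAt (fun z => v + (k ‖z‖ • rot z) v • (I * z)) _ z :=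
    (h2.smul ((hasFDerivAt_id z).const_mul I)).const_add v
  have h4 : (fun z => frame k z v) = fun z => v + (k ‖z‖ • rot z) v • (I * z) := by
    ext1 z
    rw [frame_apply, real_smul]
    rfl
  rw [h4] at h1
  have h5 := DFunLike.congr_fun (h1.unique h3) u
  simp only [ContinuousLinearMap.flip_apply] at h5
  rw [h5]
  simp
  ring

/-- The first structure equation. -/
theorem RadialData.fderiv_frame_sub (h : RadialData ℓ γ k q) {z : ℂ} (hz : z ∈ disc ℓ)
    (u v : ℂ) : fderiv ℝ (frame k) z u v - fderiv ℝ (frame k) z v u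
      = ((connCoeff k ‖z‖ * (u.re * v.im - u.im * v.re) : ℝ) : ℂ) * (I * z) := by
  have h1 := fderiv_smul_rot_sub h.smooth_k h.even_k hz u v
  -- The linear relation between three vectors of the plane.
  have h2 : (rot z v : ℂ) * u - (rot z u : ℂ) * v
      = ((u.re * v.im - u.im * v.re : ℝ) : ℂ) * z := by
    apply Complex.ext
    · simp
      ring
    · simp
      ring
  have h3 : ((fderiv ℝ (fun z => k ‖z‖ • rot z) z u v : ℝ) : ℂ)
      - ((fderiv ℝ (fun z => k ‖z‖ • rot z) z v u : ℝ) : ℂ)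
      = (((‖z‖ * deriv k ‖z‖ + 2 * k ‖z‖) * (u.re * v.im - u.im * v.re) : ℝ) : ℂ) := by
    rw [← h1]
    push_cast
    ring
  rw [h.fderiv_frame hz, h.fderiv_frame hz, connCoeff]
  push_cast at h2 h3 ⊢
  linear_combination (I * z) * h3 + (k ‖z‖ : ℂ) * I * h2

theorem RadialData.hasFDerivAt_frame_fst (h : RadialData ℓ γ k q) {p : ℂ × ℂ}
    (hp : p.1 ∈ disc ℓ) : HasFDerivAt (fun p : ℂ × ℂ => frame k p.1)
      ((fderiv ℝ (frame k) p.1).comp (ContinuousLinearMap.fst ℝ ℂ ℂ)) p :=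
  ((h.contDiffOn_frame.contDiffAt ((isOpen_disc ℓ).mem_nhds hp)).differentiableAt
    (by simp)).hasFDerivAt.comp p hasFDerivAt_fst

theorem RadialData.differentiableAt_frameMap (h : RadialData ℓ γ k q) {p : ℂ × ℂ}
    (hp : p.1 ∈ disc ℓ) : DifferentiableAt ℝ (frameMap k) p :=
  (h.contDiffOn_frameMap.contDiffAt ((isOpen_disc_prod ℓ).mem_nhds ⟨hp, mem_univ _⟩)).differentiableAt
    (by simp)

theorem RadialData.fderiv_liouvilleL (h : RadialData ℓ γ k q) {p : ℂ × ℂ} (hp : p.1 ∈ disc ℓ)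
    (ξ η : ℂ × ℂ) : fderiv ℝ (liouvilleL k) p ξ η
      = (fderiv ℝ (frameMap k) p ξ).re * (frame k p.1 η.1).re
        + (fderiv ℝ (frameMap k) p ξ).im * (frame k p.1 η.1).im
        + ((frameMap k p).re * (fderiv ℝ (frame k) p.1 ξ.1 η.1).re
        + (frameMap k p).im * (fderiv ℝ (frame k) p.1 ξ.1 η.1).im) := by
  have hd : DifferentiableAt ℝ (liouvilleL k) p := (h.contDiffOn_liouvilleL.contDiffAt
    ((isOpen_disc_prod ℓ).mem_nhds ⟨hp, mem_univ _⟩)).differentiableAt (by simp)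
  have h1 : HasFDerivAt (fun p => liouvilleL k p η) ((fderiv ℝ (liouvilleL k) p).flip η) p := by
    simpa using hd.hasFDerivAt.clm_apply (hasFDerivAt_const η p)
  have hW := (h.differentiableAt_frameMap hp).hasFDerivAt
  have hθ : HasFDerivAt (fun p : ℂ × ℂ => frame k p.1 η.1) _ p :=
    (h.hasFDerivAt_frame_fst hp).clm_apply (hasFDerivAt_const η.1 p)
  have h2 : HasFDerivAt (fun p => liouvilleL k p η) _ p :=
    ((reCLM.hasFDerivAt.comp p hW).mul (reCLM.hasFDerivAt.comp p hθ)).add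
      ((imCLM.hasFDerivAt.comp p hW).mul (imCLM.hasFDerivAt.comp p hθ))
  have h3 := DFunLike.congr_fun (h1.unique h2) ξ
  simp only [ContinuousLinearMap.flip_apply] at h3
  rw [h3]
  simp
  ring

/-- With W the framed velocity and θ the frame, λ is the real part of conj(W) θ. Leibniz gives the
terms in dW, and the first structure equation evaluates dθ. -/
theorem RadialData.extDeriv_liouville (h : RadialData ℓ γ k q) (i : Pole) {p : ℂ × ℂ}
    (hp : p.1 ∈ disc ℓ) (ξ η : ℂ × ℂ) : extDeriv (liouville ℓ γ i) p ![ξ, η]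
      = ((fderiv ℝ (frameMap k) p ξ).re * (frame k p.1 η.1).re
        + (fderiv ℝ (frameMap k) p ξ).im * (frame k p.1 η.1).im)
        - ((fderiv ℝ (frameMap k) p η).re * (frame k p.1 ξ.1).re
        + (fderiv ℝ (frameMap k) p η).im * (frame k p.1 ξ.1).im)
        + connCoeff k ‖p.1‖ * (ξ.1.re * η.1.im - ξ.1.im * η.1.re)
          * ((frameMap k p).im * p.1.re - (frameMap k p).re * p.1.im) := by
  have hd : DifferentiableAt ℝ (liouvilleL k) p := (h.contDiffOn_liouvilleL.contDiffAt
    ((isOpen_disc_prod ℓ).mem_nhds ⟨hp, mem_univ _⟩)).differentiableAt (by simp)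
  have h1 : liouville ℓ γ i =ᶠ[𝓝 p] fun p => toAlt (liouvilleL k p) := by
    filter_upwards [(isOpen_disc_prod ℓ).mem_nhds ⟨hp, mem_univ _⟩] with x hx
    exact h.liouville_eq i hx.1
  have h2 := h.fderiv_frame_sub hp ξ.1 η.1
  have h3 := congrArg Complex.re h2
  have h4 := congrArg Complex.im h2
  rw [re_ofReal_mul] at h3
  rw [im_ofReal_mul] at h4
  simp only [sub_re, sub_im, mul_re, mul_im, I_re, I_im] at h3 h4
  rw [h1.extDeriv_eq, extDeriv_toAlt hd, h.fderiv_liouvilleL hp, h.fderiv_liouvilleL hp]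
  linear_combination (frameMap k p).re * h3 + (frameMap k p).im * h4

theorem RadialData.extDeriv_potForm (h : RadialData ℓ γ k q) (i : Pole) {p : ℂ × ℂ}
    (hp : p.1 ∈ disc ℓ) (ξ η : ℂ × ℂ) :
    extDeriv (fun p => toAlt (potForm q p)) p ![ξ, η] = area ℓ γ i p.1 ξ.1 η.1 := by
  have hd : DifferentiableAt ℝ (potForm q) p := (h.contDiffOn_potForm.contDiffAt
    ((isOpen_disc_prod ℓ).mem_nhds ⟨hp, mem_univ _⟩)).differentiableAt (by simp)
  have hb : DifferentiableAt ℝ (fun z => q ‖z‖ • rot z) p.1 :=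
    ((contDiffOn_smul_rot h.smooth_q h.even_q).contDiffAt
      ((isOpen_disc ℓ).mem_nhds hp)).differentiableAt (by simp)
  have h1 : ∀ ξ η, fderiv ℝ (potForm q) p ξ η
      = fderiv ℝ (fun z => q ‖z‖ • rot z) p.1 ξ.1 η.1 := by
    intro ξ η
    have h2 : HasFDerivAt (potForm q) _ p := (hb.hasFDerivAt.comp p hasFDerivAt_fst).clm_comp
      (hasFDerivAt_const (ContinuousLinearMap.fst ℝ ℂ ℂ) p)
    rw [h2.fderiv]
    simp
  rw [extDeriv_toAlt hd, h1, h1, fderiv_smul_rot_sub h.smooth_q h.even_q hp, h.area_eq i hp,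
    h.deriv_q _ (norm_mem_Ioo hp)]

theorem RadialData.differentiableAt_angForm (h : RadialData ℓ γ k q) {p : ℂ × ℂ}
    (hp : p ∈ tdisc ℓ) : DifferentiableAt ℝ (angForm k) p :=
  (h.contDiffOn_angForm.contDiffAt ((isOpen_tdisc ℓ).mem_nhds hp)).differentiableAt (by simp)

/-- The form is Im(dW / W), locally the differential of the argument of W. It is closed because
second derivatives are symmetric and dW(ξ) dW(η) commutes in ℂ. -/
theorem RadialData.extDeriv_angForm (h : RadialData ℓ γ k q) {p : ℂ × ℂ}
    (hp : p ∈ tdisc ℓ) (ξ η : ℂ × ℂ) :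
    extDeriv (fun p => toAlt (angForm k p)) p ![ξ, η] = 0 := by
  have hW0 : frameMap k p ≠ 0 := h.frame_ne_zero hp.1 hp.2
  have hc : ContDiffAt ℝ ∞ (frameMap k) p :=
    h.contDiffOn_frameMap.contDiffAt ((isOpen_disc_prod ℓ).mem_nhds ⟨hp.1, mem_univ _⟩)
  have hW := (h.differentiableAt_frameMap hp.1).hasFDerivAt
  have hWi : HasFDerivAt (fun p => (frameMap k p)⁻¹) _ p :=
    (((hasDerivAt_inv hW0).hasFDerivAt.restrictScalars ℝ).comp p hW)
  have hD : HasFDerivAt (fderiv ℝ (frameMap k)) (fderiv ℝ (fderiv ℝ (frameMap k)) p) p :=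
    (((h.contDiffOn_frameMap.fderiv_of_isOpen (isOpen_disc_prod ℓ) (m := ∞)
      (by simp)).contDiffAt ((isOpen_disc_prod ℓ).mem_nhds ⟨hp.1, mem_univ _⟩)).differentiableAt
        (by simp)).hasFDerivAt
  have hsym : IsSymmSndFDerivAt ℝ (frameMap k) p :=
    (contDiffAt_infty.1 hc 2).isSymmSndFDerivAt (by simp)
  have h1 : ∀ ξ η, fderiv ℝ (angForm k) p ξ η
      = ((frameMap k p)⁻¹ * fderiv ℝ (fderiv ℝ (frameMap k)) p ξ η
        - fderiv ℝ (frameMap k) p ξ * fderiv ℝ (frameMap k) p η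
          * ((frameMap k p) ^ 2)⁻¹).im := by
    intro ξ η
    have h2 : HasFDerivAt (fun p => angForm k p η) ((fderiv ℝ (angForm k) p).flip η) p := by
      simpa using (h.differentiableAt_angForm hp).hasFDerivAt.clm_apply (hasFDerivAt_const η p)
    have h3 : HasFDerivAt (fun p => fderiv ℝ (frameMap k) p η) _ p :=
      hD.clm_apply (hasFDerivAt_const η p)
    have h4 : HasFDerivAt (fun p => angForm k p η) _ p :=
      (imCLM.hasFDerivAt.comp p (hWi.mul h3)).congr_of_eventuallyEq
        (Eventually.of_forall fun p => angForm_apply k p η)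
    have h5 := DFunLike.congr_fun (h2.unique h4) ξ
    simp only [ContinuousLinearMap.flip_apply] at h5
    rw [h5]
    simp
    ring
  rw [extDeriv_toAlt (h.differentiableAt_angForm hp), h1, h1, hsym ξ η,
    mul_comm (fderiv ℝ (frameMap k) p ξ), sub_self]

theorem RadialData.extDeriv_contactForm (h : RadialData ℓ γ k q) (s : ℝ) (i : Pole) {p : ℂ × ℂ}
    (hp : p ∈ tdisc ℓ) (ξ η : ℂ × ℂ) :
    extDeriv (contactForm ℓ γ k q s i) p ![ξ, η] = magneticForm ℓ γ s i p ξ η := by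
  have hopen := (isOpen_disc_prod ℓ).mem_nhds (⟨hp.1, mem_univ _⟩ : p ∈ disc ℓ ×ˢ univ)
  have hdL : DifferentiableAt ℝ (liouville ℓ γ i) p := by
    have h1 : liouville ℓ γ i =ᶠ[𝓝 p] fun p => toAlt (liouvilleL k p) := by
      filter_upwards [hopen] with x hx using h.liouville_eq i hx.1
    exact (differentiableAt_toAlt ((h.contDiffOn_liouvilleL.contDiffAt hopen).differentiableAt
      (by simp))).congr_of_eventuallyEq h1
  have hda := differentiableAt_toAlt (h.differentiableAt_angForm hp)
  have hdp := differentiableAt_toAlt ((h.contDiffOn_potForm.contDiffAt hopen).differentiableAt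
    (by simp))
  have h1 : contactForm ℓ γ k q s i = liouville ℓ γ i + (s • (fun p => toAlt (angForm k p))
      + (-s) • fun p => toAlt (potForm q p)) := by
    ext p m
    simp [contactForm, toAlt]
    ring
  rw [h1, extDeriv_add hdL ((hda.const_smul s).add (hdp.const_smul (-s))),
    extDeriv_add (hda.const_smul s) (hdp.const_smul (-s)), extDeriv_smul, extDeriv_smul]
  simp only [ContinuousAlternatingMap.add_apply, ContinuousAlternatingMap.smul_apply]
  rw [h.extDeriv_angForm hp, h.extDeriv_potForm i hp.1, magneticForm, smul_eq_mul, smul_eq_mul]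
  ring

end Contact

/-! ## Positivity -/

section Positivity

variable {ℓ : ℝ} {γ k q : ℝ → ℝ}

theorem RadialData.fderiv_energy (h : RadialData ℓ γ k q) (i : Pole) {p : ℂ × ℂ}
    (hp : p.1 ∈ disc ℓ) (ξ : ℂ × ℂ) : fderiv ℝ (energy ℓ γ i) p ξ
      = (frameMap k p).re * (fderiv ℝ (frameMap k) p ξ).re
        + (frameMap k p).im * (fderiv ℝ (frameMap k) p ξ).im := by
  have hW := (h.differentiableAt_frameMap hp).hasFDerivAt
  have h1 : energy ℓ γ i =ᶠ[𝓝 p] fun p => ((frameMap k p).re * (frameMap k p).re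
      + (frameMap k p).im * (frameMap k p).im) / 2 := by
    filter_upwards [(isOpen_disc_prod ℓ).mem_nhds ⟨hp, mem_univ _⟩] with x hx
    rw [energy, h.metric_eq i hx.1]
    rfl
  have hre := reCLM.hasFDerivAt.comp p hW
  have him := imCLM.hasFDerivAt.comp p hW
  have h2 : HasFDerivAt (fun p => ((frameMap k p).re * (frameMap k p).re
      + (frameMap k p).im * (frameMap k p).im) * (2 : ℝ)⁻¹) _ p :=
    ((hre.mul hre).add (him.mul him)).mul_const (2 : ℝ)⁻¹
  rw [h1.fderiv_eq]
  simp only [div_eq_mul_inv]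
  rw [h2.fderiv]
  simp
  ring

/-- The wedge product of `λ + s (ψ - F τ)` and `ψ ∧ η - (s / M) λ ∧ η` for `τ = b λ + c η`. -/
theorem wedge_identity (L H P : Fin 3 → ℝ) (s F M b c : ℝ) :
    let α : Fin 3 → ℝ := fun i => L i + s * (P i - F * (b * L i + c * H i))
    let Λ : Fin 3 → Fin 3 → ℝ := fun i j => P i * H j - H i * P j
    let Θ : Fin 3 → Fin 3 → ℝ := fun i j => Λ i j - s * ((L i * H j - H i * L j) / M)
    α 0 * Θ 1 2 - α 1 * Θ 0 2 + α 2 * Θ 0 1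
      = (1 + s ^ 2 / M - s * (F * b)) * (L 0 * Λ 1 2 - L 1 * Λ 0 2 + L 2 * Λ 0 1) := by
  intro α Λ Θ
  simp only [α, Λ, Θ]
  ring

/-- The form dual to the Liouville form. -/
def dualForm (k : ℝ → ℝ) (p ξ : ℂ × ℂ) : ℝ :=
  (frameMap k p).re * (frame k p.1 ξ.1).im - (frameMap k p).im * (frame k p.1 ξ.1).re

/-- The connection form. -/
def connForm (k : ℝ → ℝ) (p ξ : ℂ × ℂ) : ℝ := angForm k p ξ + connCoeff k ‖p.1‖ * rot p.1 ξ.1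

/-- The Liouville form and its dual are the real and imaginary parts of conj(W) θ, so their wedge
product is |W|² times the area form. -/
theorem RadialData.area_coframe (h : RadialData ℓ γ k q) (i : Pole) {p : ℂ × ℂ}
    (hp : p ∈ tdisc ℓ) (ξ η : ℂ × ℂ) : area ℓ γ i p.1 ξ.1 η.1
      = (liouvilleL k p ξ * dualForm k p η - dualForm k p ξ * liouvilleL k p η)
        / ‖frameMap k p‖ ^ 2 := by
  have hW : frameMap k p ≠ 0 := h.frame_ne_zero hp.1 hp.2
  have hW' : ‖frameMap k p‖ ^ 2 ≠ 0 := by positivity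
  rw [h.area_eq i hp.1, ← cross_frame, eq_div_iff hW', norm_sq_eq, liouvilleL_apply,
    liouvilleL_apply, dualForm, dualForm]
  ring

/-- The coefficient of λ is found by taking ξ over v itself, where λ is |W|² and the dual form
vanishes. The value of c is left open because it drops out of α ∧ dα. -/
theorem RadialData.rot_coframe (h : RadialData ℓ γ k q) {p : ℂ × ℂ} (hp : p ∈ tdisc ℓ) :
    ∃ c, ∀ ξ : ℂ × ℂ, rot p.1 ξ.1 = rot p.1 p.2 / ‖frameMap k p‖ ^ 2 * liouvilleL k p ξ
      + c * dualForm k p ξ := by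
  have hW : frameMap k p ≠ 0 := h.frame_ne_zero hp.1 hp.2
  have hW' : ‖frameMap k p‖ ^ 2 ≠ 0 := by positivity
  have hP := (h.pos _ (norm_mem_Ico hp.1)).ne'
  refine ⟨(p.1.re * (frameMap k p).re + p.1.im * (frameMap k p).im)
    / ((1 + ‖p.1‖ ^ 2 * k ‖p.1‖) * ‖frameMap k p‖ ^ 2), fun ξ => ?_⟩
  have h1 := rot_frame k p.1 ξ.1
  have h2 := rot_frame k p.1 p.2
  have h3 := norm_sq_eq (frameMap k p)
  generalize 1 + ‖p.1‖ ^ 2 * k ‖p.1‖ = P at *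
  refine mul_left_cancel₀ hP ?_
  rw [← h1]
  generalize ‖frameMap k p‖ ^ 2 = M at *
  rw [liouvilleL_apply, dualForm]
  field_simp
  rw [← h2]
  simp only [rot_apply, frameMap] at *
  rw [h3]
  ring

/-- The second structure equation, on the tangent spaces of the energy levels. -/
theorem RadialData.extDeriv_liouville_tangent (h : RadialData ℓ γ k q) (i : Pole) {p : ℂ × ℂ}
    (hp : p ∈ tdisc ℓ) {ξ η : ℂ × ℂ} (hξ : ξ ∈ levelTangent ℓ γ i p)
    (hη : η ∈ levelTangent ℓ γ i p) : extDeriv (liouville ℓ γ i) p ![ξ, η]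
      = connForm k p ξ * dualForm k p η - dualForm k p ξ * connForm k p η := by
  have hW : frameMap k p ≠ 0 := h.frame_ne_zero hp.1 hp.2
  have hW' : ‖frameMap k p‖ ^ 2 ≠ 0 := by positivity
  -- Along a level |W| is constant, so dW / W is purely imaginary.
  have hang : ∀ ξ ∈ levelTangent ℓ γ i p,
      fderiv ℝ (frameMap k) p ξ = (angForm k p ξ : ℂ) * (I * frameMap k p) := by
    intro ξ hξ
    have h1 : fderiv ℝ (energy ℓ γ i) p ξ = 0 := hξ
    rw [h.fderiv_energy i hp.1] at h1
    have h2 : ((frameMap k p)⁻¹ * fderiv ℝ (frameMap k) p ξ).re = 0 := by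
      rw [mul_re, inv_re, inv_im, ← Complex.sq_norm]
      field_simp
      linarith
    have h3 : (frameMap k p)⁻¹ * fderiv ℝ (frameMap k) p ξ = (angForm k p ξ : ℂ) * I := by
      apply Complex.ext
      · rw [h2]
        simp
      · rw [angForm_apply]
        simp
    rw [← mul_assoc, ← h3]
    field_simp
  have hrot : (rot p.1 ξ.1 : ℂ) * frame k p.1 η.1 - (rot p.1 η.1 : ℂ) * frame k p.1 ξ.1
      = -((ξ.1.re * η.1.im - ξ.1.im * η.1.re : ℝ) : ℂ) * p.1 := by
    rw [frame_apply, frame_apply]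
    apply Complex.ext
    · simp
      ring
    · simp
      ring
  have h4 := congrArg Complex.re hrot
  have h5 := congrArg Complex.im hrot
  rw [← ofReal_neg] at h4 h5
  simp only [sub_re, sub_im, re_ofReal_mul, im_ofReal_mul] at h4 h5
  rw [h.extDeriv_liouville i hp.1, hang ξ hξ, hang η hη]
  simp only [re_ofReal_mul, im_ofReal_mul, I_mul_re, I_mul_im, connForm, dualForm]
  linear_combination connCoeff k ‖p.1‖ * (frameMap k p).im * h4
    - connCoeff k ‖p.1‖ * (frameMap k p).re * h5

theorem RadialData.mem_tdisc_of_level (h : RadialData ℓ γ k q) {m : ℝ} (hm : 0 < m) {i : Pole}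
    {p : ℂ × ℂ} (hp : p ∈ level ℓ γ m i) : p ∈ tdisc ℓ ∧ ‖frameMap k p‖ = m := by
  have h1 : energy ℓ γ i p = m ^ 2 / 2 := hp.2
  rw [energy, h.metric_self i hp.1] at h1
  have h2 : ‖frameMap k p‖ = m := by
    rw [← sq_eq_sq₀ (norm_nonneg _) hm.le]
    unfold frameMap
    linarith
  refine ⟨⟨hp.1, fun h0 => ?_⟩, h2⟩
  rw [frameMap, show p.2 = 0 from h0, map_zero, norm_zero] at h2
  exact hm.ne h2

theorem RadialData.wedge_contactForm_pos (h : RadialData ℓ γ k q) {m s : ℝ} (hm : 0 < m)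
    (hs : 0 ≤ s) {i : Pole} {p : ℂ × ℂ} (hp : p ∈ level ℓ γ m i) {u v w : ℂ × ℂ}
    (hu : u ∈ levelTangent ℓ γ i p) (hv : v ∈ levelTangent ℓ γ i p)
    (hw : w ∈ levelTangent ℓ γ i p)
    (hpos : 0 < wedge (liouville ℓ γ i p) (extDeriv (liouville ℓ γ i) p) u v w) :
    0 < wedge (contactForm ℓ γ k q s i p) (extDeriv (contactForm ℓ γ k q s i) p) u v w := by
  obtain ⟨hpt, hnorm⟩ := h.mem_tdisc_of_level hm hp
  obtain ⟨c, hc⟩ := h.rot_coframe hpt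
  set b := rot p.1 p.2 / ‖frameMap k p‖ ^ 2 with hb
  set F := connCoeff k ‖p.1‖ + q ‖p.1‖ with hF
  have hα : ∀ ξ, contactForm ℓ γ k q s i p ![ξ] = liouvilleL k p ξ
      + s * (connForm k p ξ - F * (b * liouvilleL k p ξ + c * dualForm k p ξ)) := by
    intro ξ
    rw [← hc ξ, contactForm, h.liouville_eq i hpt.1]
    change liouvilleL k p ξ + s * (angForm k p ξ - potForm q p ξ) = _
    rw [potForm_apply, connForm, hF]
    ring
  have hlam : ∀ ξ, liouville ℓ γ i p ![ξ] = liouvilleL k p ξ := fun ξ => by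
    rw [h.liouville_eq i hpt.1]
    rfl
  have hdα : ∀ ξ ∈ levelTangent ℓ γ i p, ∀ η ∈ levelTangent ℓ γ i p,
      extDeriv (contactForm ℓ γ k q s i) p ![ξ, η]
        = (connForm k p ξ * dualForm k p η - dualForm k p ξ * connForm k p η)
          - s * ((liouvilleL k p ξ * dualForm k p η - dualForm k p ξ * liouvilleL k p η)
            / ‖frameMap k p‖ ^ 2) := by
    intro ξ hξ η hη
    rw [h.extDeriv_contactForm s i hpt, magneticForm, h.extDeriv_liouville_tangent i hpt hξ hη,
      h.area_coframe i hpt]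
  have key := wedge_identity (fun j => liouvilleL k p (![u, v, w] j))
    (fun j => dualForm k p (![u, v, w] j)) (fun j => connForm k p (![u, v, w] j)) s F
    (‖frameMap k p‖ ^ 2) b c
  simp only [Matrix.cons_val_zero, Matrix.cons_val_one, Matrix.cons_val] at key
  rw [wedge, hlam, hlam, hlam, h.extDeriv_liouville_tangent i hpt hv hw,
    h.extDeriv_liouville_tangent i hpt hu hw, h.extDeriv_liouville_tangent i hpt hu hv] at hpos
  rw [wedge, hα, hα, hα, hdα v hv w hw, hdα u hu w hw, hdα u hu v hv, key]
  refine mul_pos ?_ hpos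
  have hbound : |F * rot p.1 p.2| ≤ m := by
    rw [← hnorm]
    exact h.abs_rot_le hpt.1 p.2
  have h1 := (abs_le.1 hbound).2
  have h2 : 1 + s ^ 2 / ‖frameMap k p‖ ^ 2 - s * (F * b)
      = (m ^ 2 + s ^ 2 - s * (F * rot p.1 p.2)) / m ^ 2 := by
    rw [hb, hnorm]
    field_simp
  rw [h2]
  refine div_pos ?_ (by positivity)
  -- The numerator is at least m² - s m + s², a positive definite quadratic form in (m, s).
  nlinarith [mul_le_mul_of_nonneg_left h1 hs, sq_nonneg (m - s), mul_pos hm hm]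

end Positivity

/-! ## Compatibility with the transition map -/

section Compatibility

variable {ℓ : ℝ} {γ k q : ℝ → ℝ}

/-- The transition map is an orientation-preserving isometry, so the two orthonormal frames differ
by a rotation, here by -exp(-2iφ). -/
theorem RadialData.frame_glue (h : RadialData ℓ γ k q) {z : ℂ} (hz : z ∈ annulus ℓ) (u : ℂ) :
    frame k (glue ℓ z) (fderiv ℝ (glue ℓ) z u)
      = -((starRingEnd ℂ) z / z) * frame k z u := by
  have hr := norm_mem_Ioo_of_annulus hz
  have hr0 : ‖z‖ ≠ 0 := hr.1.ne'
  have hr1 : ℓ - ‖z‖ ≠ 0 := by linarith [hr.2]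
  have hz0 : z ≠ 0 := hz.2
  have hp1 := h.profile ‖z‖ ⟨hr.1.le, hr.2⟩
  have hp2 := h.profile (ℓ - ‖z‖) ⟨by linarith [hr.2], by linarith [hr.1]⟩
  rw [← h.symm _ ⟨hr.1.le, hr.2.le⟩, hp1] at hp2
  -- Solves γ(r) = γ(ℓ - r) for the value of k in the opposite chart.
  have hk : k (ℓ - ‖z‖) = (‖z‖ * (1 + ‖z‖ ^ 2 * k ‖z‖) - (ℓ - ‖z‖)) / (ℓ - ‖z‖) ^ 3 := by
    field_simp
    linarith
  have hrc : (‖z‖ : ℂ) ≠ 0 := by exact_mod_cast hr0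
  have hrc1 : (ℓ : ℂ) - ‖z‖ ≠ 0 := by exact_mod_cast hr1
  have hN : (‖z‖ : ℂ) ^ 2 = z * (starRingEnd ℂ) z := (mul_conj' z).symm
  have hu : u = z * (dotL z u + rot z u * I) / (‖z‖ : ℂ) ^ 2 := by
    rw [hN, mul_div_mul_left _ _ hz0, eq_div_iff ((map_ne_zero _).2 hz0)]
    apply Complex.ext
    · simp
      ring
    · simp
      ring
  have hu' : (starRingEnd ℂ) u
      = (starRingEnd ℂ) z * (dotL z u - rot z u * I) / (‖z‖ : ℂ) ^ 2 := by
    conv_lhs => rw [hu]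
    simp [sub_eq_add_neg]
  rw [frame_apply, frame_apply, norm_glue hz, rot_glue hz, fderiv_glue_apply hz, hk, glue, hu']
  generalize dotL z u = D at hu ⊢
  generalize rot z u = τ at hu ⊢
  rw [hu, real_smul]
  push_cast
  field_simp
  ring

theorem contDiffOn_glue : ContDiffOn ℝ ∞ (glue ℓ) (annulus ℓ) := by
  intro z hz
  have hn : ContDiffAt ℝ ∞ (fun z : ℂ => ‖z‖) z := contDiffAt_norm ℝ hz.2
  exact (((contDiffAt_const.sub hn).div hn (norm_ne_zero_iff.2 hz.2)).smul
    conjCLE.contDiff.contDiffAt).contDiffWithinAt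

theorem isOpen_annulus (ℓ : ℝ) : IsOpen (annulus ℓ) := (isOpen_disc ℓ).sdiff isClosed_singleton

theorem differentiableAt_tglue {p : ℂ × ℂ} (hp : p.1 ∈ annulus ℓ) :
    DifferentiableAt ℝ (tglue ℓ) p := by
  have hopen := (isOpen_annulus ℓ).mem_nhds hp
  have h1 : DifferentiableAt ℝ (glue ℓ) p.1 := (hasFDerivAt_glue ℓ hp.2).differentiableAt
  have h2 : DifferentiableAt ℝ (fderiv ℝ (glue ℓ)) p.1 :=
    ((contDiffOn_glue.fderiv_of_isOpen (isOpen_annulus ℓ) (m := ∞) (by simp)).contDiffAt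
      hopen).differentiableAt (by simp)
  exact (h1.comp p differentiableAt_fst).prodMk
    ((h2.comp p differentiableAt_fst).clm_apply differentiableAt_snd)

theorem fderiv_tglue_fst {p : ℂ × ℂ} (hp : p.1 ∈ annulus ℓ) (ξ : ℂ × ℂ) :
    (fderiv ℝ (tglue ℓ) p ξ).1 = fderiv ℝ (glue ℓ) p.1 ξ.1 := by
  have h1 := (differentiableAt_tglue hp).hasFDerivAt.fst
  have h2 := (hasFDerivAt_glue ℓ hp.2).differentiableAt.hasFDerivAt.comp p hasFDerivAt_fst
  exact DFunLike.congr_fun (h1.unique h2) ξ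

theorem RadialData.frameMap_tglue (h : RadialData ℓ γ k q) {p : ℂ × ℂ} (hp : p.1 ∈ annulus ℓ) :
    frameMap k (tglue ℓ p) = -((starRingEnd ℂ) p.1 / p.1) * frameMap k p :=
  h.frame_glue hp p.2

/-- The argument of -conj(z) / z is π - 2φ up to multiples of 2π, so the angle form changes by -2
dφ. -/
theorem RadialData.angForm_tglue (h : RadialData ℓ γ k q) {p : ℂ × ℂ} (hp : p ∈ tannulus ℓ)
    (ξ : ℂ × ℂ) : angForm k (tglue ℓ p) (fderiv ℝ (tglue ℓ) p ξ)
      = angForm k p ξ - 2 / ‖p.1‖ ^ 2 * rot p.1 ξ.1 := by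
  have hz0 : p.1 ≠ 0 := hp.1.2
  have hc0 : (starRingEnd ℂ) p.1 ≠ 0 := (map_ne_zero _).2 hz0
  have hW0 : frameMap k p ≠ 0 := h.frame_ne_zero hp.1.1 hp.2
  have hT := (differentiableAt_tglue hp.1).hasFDerivAt
  have hW := (h.differentiableAt_frameMap hp.1.1).hasFDerivAt
  have hWT := (h.differentiableAt_frameMap (p := tglue ℓ p)
    (glue_mem_annulus hp.1).1).hasFDerivAt.comp p hT
  have h1 : frameMap k ∘ tglue ℓ =ᶠ[𝓝 p]
      fun p => (-((starRingEnd ℂ) p.1 * p.1⁻¹)) * frameMap k p := by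
    filter_upwards [((isOpen_annulus ℓ).prod isOpen_univ).mem_nhds
      (⟨hp.1, mem_univ _⟩ : p ∈ annulus ℓ ×ˢ univ)] with x hx
    rw [← div_eq_mul_inv]
    exact h.frameMap_tglue hx.1
  have hfst : HasFDerivAt (fun p : ℂ × ℂ => p.1) (ContinuousLinearMap.fst ℝ ℂ ℂ) p :=
    hasFDerivAt_fst
  have hconj : HasFDerivAt (fun p : ℂ × ℂ => (starRingEnd ℂ) p.1) _ p :=
    (conjCLE : ℂ →L[ℝ] ℂ).hasFDerivAt.comp p hfst
  have hinv : HasFDerivAt (fun p : ℂ × ℂ => p.1⁻¹) _ p :=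
    ((hasDerivAt_inv hz0).hasFDerivAt.restrictScalars ℝ).comp p hfst
  have h2 : HasFDerivAt (fun p => (-((starRingEnd ℂ) p.1 * p.1⁻¹)) * frameMap k p) _ p :=
    ((hconj.mul hinv).neg).mul hW
  have h3 := DFunLike.congr_fun (hWT.unique (h2.congr_of_eventuallyEq h1)) ξ
  rw [ContinuousLinearMap.comp_apply] at h3
  rw [angForm_apply, angForm_apply, h3, h.frameMap_tglue hp.1]
  have h4 : (-((starRingEnd ℂ) p.1 / p.1) * frameMap k p)⁻¹
      * (-((starRingEnd ℂ) p.1 * p.1⁻¹) * fderiv ℝ (frameMap k) p ξ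
        + frameMap k p * -((starRingEnd ℂ) p.1 * (-(p.1 ^ 2)⁻¹ * ξ.1)
          + p.1⁻¹ * (starRingEnd ℂ) ξ.1))
      = (frameMap k p)⁻¹ * fderiv ℝ (frameMap k) p ξ
        + ((starRingEnd ℂ) (ξ.1 / p.1) - ξ.1 / p.1) := by
    rw [map_div₀]
    field_simp
    ring
  have h5 : ((starRingEnd ℂ) (ξ.1 / p.1) - ξ.1 / p.1).im = -(2 / ‖p.1‖ ^ 2 * rot p.1 ξ.1) := by
    rw [sub_im, conj_im, div_im, ← Complex.sq_norm, rot_apply]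
    field_simp
    ring
  rw [sub_eq_add_neg, ← h5, ← add_im, ← h4]
  congr 2
  simp
  ring

theorem RadialData.liouvilleL_tglue (h : RadialData ℓ γ k q) {p : ℂ × ℂ} (hp : p.1 ∈ annulus ℓ)
    (ξ : ℂ × ℂ) : liouvilleL k (tglue ℓ p) (fderiv ℝ (tglue ℓ) p ξ) = liouvilleL k p ξ := by
  have hn : ‖(starRingEnd ℂ) p.1 / p.1‖ = 1 := by
    rw [norm_div, RCLike.norm_conj, div_self (norm_ne_zero_iff.2 hp.2)]
  have h1 := norm_sq_eq ((starRingEnd ℂ) p.1 / p.1)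
  rw [hn] at h1
  rw [liouvilleL_apply, fderiv_tglue_fst hp, h.frameMap_tglue hp]
  change _ * (frame k (glue ℓ p.1) _).re + _ * (frame k (glue ℓ p.1) _).im = _
  rw [h.frame_glue hp, liouvilleL_apply]
  generalize (starRingEnd ℂ) p.1 / p.1 = ζ at *
  simp only [mul_re, mul_im, neg_re, neg_im]
  linear_combination (-((frameMap k p).re * (frame k p.1 ξ.1).re
    + (frameMap k p).im * (frame k p.1 ξ.1).im)) * h1

/-- The Liouville form is invariant; the angle form and the potential both change by -2 dφ, the
latter by `glue_q`, so their difference is invariant. -/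
theorem RadialData.contactForm_compatible (h : RadialData ℓ γ k q) (s : ℝ) (i : Pole) {p : ℂ × ℂ}
    (hp : p ∈ tannulus ℓ) : contactForm ℓ γ k q s i p
      = (contactForm ℓ γ k q s i.opp (tglue ℓ p)).compContinuousLinearMap
        (fderiv ℝ (tglue ℓ) p) := by
  rw [alt_ext_iff]
  intro ξ
  rw [contactForm, contactForm, h.liouville_eq i hp.1.1,
    h.liouville_eq i.opp (p := tglue ℓ p) (glue_mem_annulus hp.1).1]
  change liouvilleL k p ξ + s * (angForm k p ξ - potForm q p ξ)
    = liouvilleL k (tglue ℓ p) (fderiv ℝ (tglue ℓ) p ξ)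
      + s * (angForm k (tglue ℓ p) (fderiv ℝ (tglue ℓ) p ξ)
        - potForm q (tglue ℓ p) (fderiv ℝ (tglue ℓ) p ξ))
  have h1 := smul_rot_glue h.glue_q hp.1 ξ.1
  rw [h.liouvilleL_tglue hp.1, h.angForm_tglue hp, potForm_apply, potForm_apply,
    fderiv_tglue_fst hp.1]
  change _ = _ + s * (_ - q ‖glue ℓ p.1‖ * rot (glue ℓ p.1) _)
  rw [h1]
  ring

theorem RadialData.isPositiveContact (h : RadialData ℓ γ k q) {m s : ℝ} (hm : 0 < m)
    (hs : 0 ≤ s) : IsPositiveContact ℓ γ m s := by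
  refine ⟨contactForm ℓ γ k q s, ⟨fun i => h.contDiffOn_contactForm s i,
    fun i p hp => h.contactForm_compatible s i hp⟩, fun i p hp ξ _ η _ =>
      h.extDeriv_contactForm s i (h.mem_tdisc_of_level hm hp).1 ξ η, fun i p hp u hu v hv w hw =>
        h.wedge_contactForm_pos hm hs hp hu hv hw⟩

end Compatibility

end RevSphere

end

theorem mainTheorem10 (ℓ : ℝ) (γ : ℝ → ℝ) (hγ : RevSphere.IsNormalisedProfile ℓ γ)
    (hsymm : ∀ t ∈ Set.Icc 0 ℓ, γ t = γ (ℓ - t))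
    (hK : MonotoneOn (RevSphere.curvature ℓ γ) (Set.Icc 0 (ℓ / 2))) :
    RevSphere.mGamma ℓ γ ≤ 1 ∧
    RevSphere.con ℓ γ = Set.Ici 0 ∧
    ∀ m : ℝ, 0 < m → RevSphere.IsPositiveContact ℓ γ m 1 := by
  obtain ⟨k, q, h⟩ := RevSphere.exists_radialData hγ hsymm hK
  refine ⟨h.mGamma_le_one, ?_, fun m hm => h.isPositiveContact hm zero_le_one⟩
  ext m
  simp only [RevSphere.con, RevSphere.conPlus, mem_union, mem_ofPred_eq, mem_singleton_iff,
    mem_Ici]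
  constructor
  · rintro (⟨hm, -⟩ | rfl)
    · exact hm.le
    · exact le_rfl
  · intro hm
    rcases eq_or_lt_of_le hm with rfl | hm
    · exact Or.inr rfl
    · exact Or.inl ⟨hm, by positivity, h.isPositiveContact one_pos (by positivity)⟩
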